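/- **Setting.** A $\mathbb Z$-graded graph $G=(V,E,\Pi)$ is a connected graph with countable vertex set $V$, directed edges $E$, and a rank function $\Pi:V\to\mathbb Z$ with $\Pi(y)=\Pi(x)+1$ for every $(x,y)\in E$. It carries measures $\mu_V:V\to(0,\infty)$ and $\mu_E:E\to(0,\infty)$ that restrict to probability measures on every vertex layer $\Pi^{-1}(n)$ and on every edge layer $\{(x,y)\in E:\Pi(x)=n\}$, $n\in\mathbb Z$. Assume the measure balance condition: for all $x\in V$, $$\mu_V(x)=\sum_{(x,y)\in E}\mu_E(x,y)=\sum_{(y,x)\in E}\mu_E(y,x).$$ Let $U(r)=e^{-r}-1$. A solution of the Toda equations on $G$ on an interval $I\ni0$ is a curve $c=(q_t,\dot q_t):I\to\ell^\infty(V)\oplus\ell^\infty(V)$ (real-valued sequences), differentiable in the sup norm, with $\frac{d}{dt}c(t)=X(c(t))$ for all $t\in I$, where $X(q,v)=(v,F(q))$ and $$F(q)(x)=\sum_{(x,y)\in E}\frac{\mu_E(x,y)}{\mu_V(x)}U'(q(y)-q(x))-\sum_{(y,x)\in E}\frac{\mu_E(y,x)}{\mu_V(x)}U'(q(x)-q(y)).$$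 The 1D Toda chain is the case $V=\mathbb Z$, $E=\{(n,n+1)\}$, $\Pi=\mathrm{id}$, all measures equal to $1$. The radial lift of a curve $c=(q,\dot q)$ in $\ell^\infty(\mathbb Z)\oplus\ell^\infty(\mathbb Z)$ is $P^*c=(P^*q,P^*\dot q)$, with $(P^*\varphi)(x)=\varphi(\Pi(x))$. **Statement.** 1. For every $z_0\in\ell^\infty(\mathbb Z)\oplus\ell^\infty(\mathbb Z)$ there is a solution $c$ of the 1D Toda chain on all of $\mathbb R$ with $c(0)=z_0$, and every solution on an interval $I\ni 0$ with initial value $z_0$ agrees with $c$ on $I$. Its radial lift $P^*c$ is a solution on $G$ for all $t\in\mathbb R$ with initial value $P^*z_0$, and every solution on $G$ on an interval $I\ni0$ with initial value $P^*z_0$ agrees with $P^*c$ on $I$. 2. Let $N\ge0$, $q_0\in\mathbb R$, $\kappa_j,\gamma_j>0$, $\sigma_j\in\{\pm1\}$ $(1\le j\le N)$, and $$q_N(n,t)=q_0-\ln\frac{\det(\mathbb 1+C_N(n,t))}{\det(\mathbb 1+C_N(n-1,t))},\qquad C_N(n,t)=\left(\frac{\sqrt{\gamma_i\gamma_j}}{1-\sigma_i\sigma_je^{-(\kappa_i+\kappa_j)}}\,e^{-(\kappa_i+\kappa_j)n-(\sigma_i\sinh\kappa_i+\sigma_j\sinh\kappa_j)t}\right)_{1\le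 i,j\le N}.$$ Then all determinants $\det(\mathbb 1+C_N(n,t))$ are positive, $t\mapsto (q_N(\cdot,t),\dot q_N(\cdot,t))$ takes values in $\ell^\infty(\mathbb Z)\oplus\ell^\infty(\mathbb Z)$ and is a solution of the 1D Toda chain on $\mathbb R$, and its radial lift $q_{G,N}(t)=(P^*q_N(\cdot,t),P^*\dot q_N(\cdot,t))$ is an $N$-soliton solution on $G$: it is a solution on $G$ for all $t\in\mathbb R$; there are constants $a,b$ independent of $t$ such that for every $t$ its displacement tends to $a$ as $\Pi(x)\to+\infty$ and to $b$ as $\Pi(x)\to-\infty$, while its velocity tends to $0$ in both cases; and every solution on $G$ on an interval $I\ni0$ with the same initial value agrees with it on $I$, hence stays radial. -/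

import Mathlib

open scoped ENNReal Topology
open Filter Set

noncomputable section

namespace GradedToda

/-- A `ℤ`-graded graph: a connected graph with countable vertex set `V`, directed edges, and a
rank function to `ℤ` that increases by one along every directed edge. -/
structure ZGradedGraph (V : Type*) where
  graph : Digraph V
  rank : V → ℤ
  countable : Countable V
  connected : graph.toSimpleGraphInclusive.Connected
  rank_edge : ∀ x y, graph.Adj x y → rank y = rank x + 1

/-- A `ℤ`-graded graph with strictly positive measures on vertices and on edges which restrict to
probability measures on every transversal layer of vertices and on every transversal layer of
edges. Only the values of `μE` on edges matter. -/
structure MeasuredZGradedGraph (V : Type*) extends ZGradedGraph V where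
  μV : V → ℝ
  μE : V → V → ℝ
  μV_pos : ∀ x, 0 < μV x
  μE_pos : ∀ x y, graph.Adj x y → 0 < μE x y
  μV_layer : ∀ n : ℤ, HasSum (fun x : {x : V // rank x = n} => μV x) 1
  μE_layer : ∀ n : ℤ,
    HasSum (fun e : {e : V × V // graph.Adj e.1 e.2 ∧ rank e.1 = n} => μE e.1.1 e.1.2) 1

/-- The Measure Balance Assumption: the measure of a vertex is the total measure of its outgoing
edges, and also the total measure of its incoming edges. -/
def MeasuredZGradedGraph.Balanced {V : Type*} (G : MeasuredZGradedGraph V) : Prop :=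
  ∀ x : V,
    HasSum (fun y : {y : V // G.graph.Adj x y} => G.μE x y) (G.μV x) ∧
    HasSum (fun y : {y : V // G.graph.Adj y x} => G.μE y x) (G.μV x)

/-- Bounded real functions on `V` with the sup norm. -/
abbrev EllInf (V : Type*) : Type _ := lp (fun _ : V => ℝ) ∞

/-- The phase space: pairs (displacement, velocity). -/
abbrev Phase (V : Type*) : Type _ := EllInf V × EllInf V

/-- The second component of the Hamiltonian vector field of
`H(q,p) = ∑ₓ p(x)² / (2 μV(x)) + ∑_{(x,y) edge} μE(x,y) U(q(y) - q(x))`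
in the variables `(q, q̇)`, `p = μV q̇`: the acceleration of the particle at `x`. -/
def MeasuredZGradedGraph.accel {V : Type*} (G : MeasuredZGradedGraph V) (U : ℝ → ℝ)
    (q : V → ℝ) (x : V) : ℝ :=
  (∑' y : {y : V // G.graph.Adj x y}, G.μE x y / G.μV x * deriv U (q y - q x)) -
    ∑' y : {y : V // G.graph.Adj y x}, G.μE y x / G.μV x * deriv U (q x - q y)

/-- `c = (q, q̇)` is an integral curve on `I` of the Hamiltonian vector field
`X(q, v) = (v, accel q)`; the derivative is taken in the Banach space `ℓ^∞(V) ⊕ ℓ^∞(V)`. -/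
def MeasuredZGradedGraph.IsSolutionOn {V : Type*} (G : MeasuredZGradedGraph V) (U : ℝ → ℝ)
    (c : ℝ → Phase V) (I : Set ℝ) : Prop :=
  ∀ t ∈ I, ∃ v : Phase V, HasDerivWithinAt c v I t ∧
    v.1 = (c t).2 ∧ ∀ x : V, v.2 x = G.accel U (fun y => (c t).1 y) x

/-- The operator `P*`, `(P* φ)(x) = φ(rank x)`, on bounded functions. -/
def ZGradedGraph.pullback {V : Type*} (G : ZGradedGraph V) (φ : EllInf ℤ) : EllInf V :=
  ⟨fun x => φ (G.rank x), by
    refine memℓp_infty ⟨‖φ‖, ?_⟩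
    rintro _ ⟨x, rfl⟩
    exact lp.norm_apply_le_norm ENNReal.top_ne_zero φ (G.rank x)⟩

/-- The radial lift of a phase space point of the chain. -/
def ZGradedGraph.lift {V : Type*} (G : ZGradedGraph V) (z : Phase ℤ) : Phase V :=
  (G.pullback z.1, G.pullback z.2)

/-- The one-dimensional chain: `ℤ` with edges `(n, n + 1)`, identity rank function and all
measures equal to one. -/
def chain : MeasuredZGradedGraph ℤ where
  graph := ⟨fun m n => n = m + 1⟩
  rank := id
  countable := inferInstance
  connected := by
    have step : ∀ n : ℤ, (Digraph.toSimpleGraphInclusive ⟨fun m n : ℤ => n = m + 1⟩).Adj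
        n (n + 1) := by
      intro n
      rw [Digraph.toSimpleGraphInclusive, SimpleGraph.fromRel_adj]
      exact ⟨by omega, Or.inl rfl⟩
    have h0 : ∀ n : ℤ, (Digraph.toSimpleGraphInclusive ⟨fun m n : ℤ => n = m + 1⟩).Reachable
        0 n := by
      intro n
      induction n using Int.induction_on with
      | zero => exact SimpleGraph.Reachable.refl _
      | succ i ih => exact ih.trans (step _).reachable
      | pred i ih =>
        refine ih.trans ?_
        have h := (step (-(i : ℤ) - 1)).symm.reachable
        rwa [sub_add_cancel] at h
    exact { preconnected := fun a b => (h0 a).symm.trans (h0 b), nonempty := ⟨0⟩ }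
  rank_edge := fun _ _ h => h
  μV := fun _ => 1
  μE := fun _ _ => 1
  μV_pos := fun _ => one_pos
  μE_pos := fun _ _ _ => one_pos
  μV_layer := fun n => by
    have : Unique {x : ℤ // id x = n} := ⟨⟨⟨n, rfl⟩⟩, fun x => Subtype.ext x.2⟩
    exact hasSum_unique _
  μE_layer := fun n => by
    have : Unique {e : ℤ × ℤ // e.2 = e.1 + 1 ∧ id e.1 = n} :=
      { default := ⟨(n, n + 1), rfl, rfl⟩
        uniq := fun ⟨⟨a, b⟩, h1, h2⟩ => by
          simp only [id] at h1 h2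
          subst h2
          subst h1
          rfl }
    exact hasSum_unique _

/-- The Toda potential. -/
def todaU (r : ℝ) : ℝ := Real.exp (-r) - 1

/-- The matrix `C_N(n,t)` of the `N`-soliton solution. -/
def solitonMatrix {N : ℕ} (κ γ σ : Fin N → ℝ) (n : ℤ) (t : ℝ) : Matrix (Fin N) (Fin N) ℝ :=
  Matrix.of fun i j =>
    Real.sqrt (γ i * γ j) / (1 - σ i * σ j * Real.exp (-(κ i + κ j))) *
      Real.exp (-(κ i + κ j) * n - (σ i * Real.sinh (κ i) + σ j * Real.sinh (κ j)) * t)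

/-- `τ(n,t) = det(1 + C_N(n,t))`. -/
def solitonTau {N : ℕ} (κ γ σ : Fin N → ℝ) (n : ℤ) (t : ℝ) : ℝ :=
  (1 + solitonMatrix κ γ σ n t).det

/-- The `N`-soliton solution `q_N(n,t)` of the Toda chain. -/
def solitonQ (q₀ : ℝ) {N : ℕ} (κ γ σ : Fin N → ℝ) (n : ℤ) (t : ℝ) : ℝ :=
  q₀ - Real.log (solitonTau κ γ σ n t / solitonTau κ γ σ (n - 1) t)

/-- A curve in phase space tends to constant values at infinity: its displacement tends to a
time-independent constant, and its velocity to zero, as the rank tends to `+∞` and to `-∞`. -/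
def ZGradedGraph.TendsToConstants {V : Type*} (G : ZGradedGraph V) (c : ℝ → Phase V) : Prop :=
  ∃ a b : ℝ, ∀ t : ℝ,
    Tendsto (fun x => (c t).1 x) (comap G.rank atTop) (𝓝 a) ∧
    Tendsto (fun x => (c t).1 x) (comap G.rank atBot) (𝓝 b) ∧
    Tendsto (fun x => (c t).2 x) (comap G.rank atTop) (𝓝 0) ∧
    Tendsto (fun x => (c t).2 x) (comap G.rank atBot) (𝓝 0)

end GradedToda

end

/-!
On a balanced graph the acceleration at a vertex is a difference of two averages, one over the
outgoing and one over the incoming edges. Two consequences are used throughout. First, the force is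
Lipschitz on balls of `ℓ^∞`, so Grönwall's inequality gives uniqueness of solutions
(`MeasuredZGradedGraph.IsSolutionOn.eqOn`). Secondly, on radial functions both averages are trivial
and the force is that of the chain, so radial lifts of solutions are solutions
(`MeasuredZGradedGraph.Balanced.lift_isSolutionOn`). It remains to study the chain.

*Global existence.* Local solutions are continued as long as they stay bounded
(`exists_integralCurve_of_apriori`). The bound comes from the Lax pair: in Flaschka's variables
`a = exp ((q - q(· + 1)) / 2) / 2`, `b = -q̇ / 2` the equations of motion read `L' = [P, L]`, with
`L` the Jacobi operator on `ℓ²(ℤ)` with coefficients `a`, `b` and `P` skew-adjoint. Hence `‖L‖` is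
conserved (`norm_eq_of_lax`). Since `‖b‖ ≤ ‖L‖`, the velocities stay bounded and the displacements
grow at most linearly (`chain_apriori`).

*Solitons.* With nodes `zᵢ = σᵢ exp (-κᵢ)` in `(-1, 1)` and suitable weights `wᵢ(n, t)` the soliton
matrix is the Cauchy-like matrix `C = (wᵢ wⱼ / (1 - zᵢ zⱼ))`. Replacing `n` by `n ± 1` changes `C`,
up to conjugation by signs, by a rank one matrix, and the time derivative of `C` has rank two. With
the matrix determinant lemma and Jacobi's formula this turns the Toda equation into an identity
between quadratic expressions in `(1 + C)⁻¹`, which follows from two commutation relations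
(`hasDerivAt_cauchyRho`). The remaining assertions concern positivity, boundedness and asymptotics.
Since `C` is a Gram matrix, its principal minors are nonnegative, and expanding `det (1 + C)` in
these minors writes the tau function as a sum of exponentials in `n` and `t` with nonnegative
coefficients (`solitonTau_eq_expSum`). Positivity and uniform bounds are then immediate, and as
`n → ±∞` the terms with extremal spatial exponent dominate; this exponent does not depend on the
time (`expSum_asymptotics`). No distinctness of the nodes is needed, because minors that
vanish simply do not contribute.
-/

namespace GradedToda

/-! ### Uniqueness of integral curves -/

theorem eq_of_locally_lipschitz_right {E : Type*} [NormedAddCommGroup E] [NormedSpace ℝ E]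
    {f g f' g' : ℝ → E} {I : Set ℝ} (hI : I.OrdConnected) (h0 : (0 : ℝ) ∈ I)
    (hf : ∀ t ∈ I, HasDerivWithinAt f (f' t) I t) (hg : ∀ t ∈ I, HasDerivWithinAt g (g' t) I t)
    (h : f 0 = g 0)
    (hK : ∀ R : ℝ, ∃ K : ℝ, ∀ t ∈ I, ‖f t‖ ≤ R → ‖g t‖ ≤ R → ‖f' t - g' t‖ ≤ K * ‖f t - g t‖)
    {b : ℝ} (hb : b ∈ I) (hb0 : 0 ≤ b) : f b = g b := by
  have hsub : Icc 0 b ⊆ I := hI.out h0 hb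
  have hfc : ContinuousOn f (Icc 0 b) := fun t ht => ((hf t (hsub ht)).continuousWithinAt).mono hsub
  have hgc : ContinuousOn g (Icc 0 b) := fun t ht => ((hg t (hsub ht)).continuousWithinAt).mono hsub
  obtain ⟨R₁, hR₁⟩ := isCompact_Icc.exists_bound_of_continuousOn hfc
  obtain ⟨R₂, hR₂⟩ := isCompact_Icc.exists_bound_of_continuousOn hgc
  obtain ⟨K, hK⟩ := hK (max R₁ R₂)
  refine sub_eq_zero.1 (eq_zero_of_abs_deriv_le_mul_abs_self_of_eq_zero_right
    (f := fun t => f t - g t)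
    (f' := fun t => f' t - g' t) (K := K) (hfc.sub hgc) ?_ (sub_eq_zero.2 h) ?_ b ⟨hb0, le_rfl⟩)
  · intro t ht
    have ht' : t ∈ Icc 0 b := Ico_subset_Icc_self ht
    have := ((hf t (hsub ht')).sub (hg t (hsub ht'))).mono hsub
    refine (this.mono (Icc_subset_Icc_left ht.1)).mono_of_mem_nhdsWithin ?_
    exact Icc_mem_nhdsGE ht.2
  · intro t ht
    have ht' : t ∈ Icc 0 b := Ico_subset_Icc_self ht
    exact hK t (hsub ht') ((hR₁ t ht').trans (le_max_left _ _))
      ((hR₂ t ht').trans (le_max_right _ _))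

/-- Two curves on an interval with the same value at `0` coincide as soon as the difference of
their velocities is controlled by the difference of their positions while both stay in a ball. -/
theorem eqOn_of_locally_lipschitz {E : Type*} [NormedAddCommGroup E] [NormedSpace ℝ E]
    {f g f' g' : ℝ → E} {I : Set ℝ} (hI : I.OrdConnected) (h0 : (0 : ℝ) ∈ I)
    (hf : ∀ t ∈ I, HasDerivWithinAt f (f' t) I t) (hg : ∀ t ∈ I, HasDerivWithinAt g (g' t) I t)
    (h : f 0 = g 0)
    (hK : ∀ R : ℝ, ∃ K : ℝ, ∀ t ∈ I, ‖f t‖ ≤ R → ‖g t‖ ≤ R → ‖f' t - g' t‖ ≤ K * ‖f t - g t‖) :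
    EqOn f g I := by
  intro b hb
  rcases le_total 0 b with hb0 | hb0
  · exact eq_of_locally_lipschitz_right hI h0 hf hg h hK hb hb0
  · -- reverse time
    have hJ : (-I).OrdConnected := ⟨fun x hx y hy z hz => by
      have := hI.out (Set.mem_neg.1 hy) (Set.mem_neg.1 hx)
      exact this ⟨neg_le_neg hz.2, neg_le_neg hz.1⟩⟩
    have rev : ∀ {F F' : ℝ → E}, (∀ t ∈ I, HasDerivWithinAt F (F' t) I t) →
        ∀ t ∈ -I, HasDerivWithinAt (fun s => F (-s)) (-F' (-t)) (-I) t := by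
      intro F F' hF t ht
      have := (hF (-t) ht).scomp t ((hasDerivAt_neg t).hasDerivWithinAt (s := -I)) (fun s hs => hs)
      simpa [Function.comp_def] using this
    have := eq_of_locally_lipschitz_right (b := -b) hJ (by simpa using h0) (rev hf) (rev hg)
      (by simpa using h) (fun R => by
        obtain ⟨K, hK⟩ := hK R
        refine ⟨K, fun t ht h1 h2 => ?_⟩
        have := hK (-t) ht h1 h2
        rwa [neg_sub_neg, norm_sub_rev]) (by simpa using hb) (by linarith)
    simpa using this

/-! ### The acceleration -/

theorem deriv_todaU (r : ℝ) : deriv todaU r = -Real.exp (-r) := by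
  have : HasDerivAt todaU (-Real.exp (-r)) r := by
    exact (((Real.hasDerivAt_exp (-r)).comp r (hasDerivAt_neg r)).sub_const 1).congr_deriv (by ring)
  exact this.deriv

theorem abs_exp_sub_exp_le {a b M : ℝ} (ha : a ≤ M) (hb : b ≤ M) :
    |Real.exp a - Real.exp b| ≤ Real.exp M * |a - b| := by
  wlog hab : b ≤ a generalizing a b
  · rw [abs_sub_comm, abs_sub_comm a b]
    exact this hb ha (le_of_not_ge hab)
  rw [abs_of_nonneg (sub_nonneg.2 (Real.exp_le_exp.2 hab)), abs_of_nonneg (sub_nonneg.2 hab)]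
  have h1 : Real.exp b = Real.exp a * Real.exp (b - a) := by rw [← Real.exp_add]; ring_nf
  have h2 := Real.add_one_le_exp (b - a)
  have h3 := Real.exp_le_exp.2 ha
  have h4 := Real.exp_pos a
  nlinarith

theorem abs_apply_le {V : Type*} (q : EllInf V) (x : V) : |q x| ≤ ‖q‖ :=
  lp.norm_apply_le_norm ENNReal.top_ne_zero q x

theorem norm_le_of_forall_abs_le {V : Type*} {q : EllInf V} {C : ℝ} (hC : 0 ≤ C)
    (h : ∀ x, |q x| ≤ C) : ‖q‖ ≤ C :=
  lp.norm_le_of_forall_le hC h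

theorem summable_weight_mul {ι : Type*} {w f : ι → ℝ} (hw : ∀ i, 0 ≤ w i) (hs : Summable w)
    {B : ℝ} (hf : ∀ i, |f i| ≤ B) : Summable fun i => w i * f i :=
  (hs.mul_right B).of_norm_bounded (fun i => by
    rw [Real.norm_eq_abs, abs_mul, abs_of_nonneg (hw i)]
    exact mul_le_mul_of_nonneg_left (hf i) (hw i))

theorem abs_tsum_weight_mul_sub_le {ι : Type*} {w f g : ι → ℝ} (hw : ∀ i, 0 ≤ w i)
    (hs : HasSum w 1) {B C : ℝ} (hf : ∀ i, |f i| ≤ B) (hg : ∀ i, |g i| ≤ B)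
    (hfg : ∀ i, |f i - g i| ≤ C) : |∑' i, w i * f i - ∑' i, w i * g i| ≤ C := by
  have hsf := summable_weight_mul hw hs.summable hf
  have hsg := summable_weight_mul hw hs.summable hg
  rw [← hsf.tsum_sub hsg, ← Real.norm_eq_abs]
  have hC : HasSum (fun i => w i * C) C := by simpa using hs.mul_right C
  refine tsum_of_norm_bounded hC fun i => ?_
  rw [← mul_sub, Real.norm_eq_abs, abs_mul, abs_of_nonneg (hw i)]
  exact mul_le_mul_of_nonneg_left (hfg i) (hw i)

variable {V : Type*}

theorem MeasuredZGradedGraph.Balanced.hasSum_out {G : MeasuredZGradedGraph V} (hG : G.Balanced)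
    (x : V) : HasSum (fun y : {y : V // G.graph.Adj x y} => G.μE x y / G.μV x) 1 := by
  simpa [div_self (G.μV_pos x).ne'] using (hG x).1.div_const (G.μV x)

theorem MeasuredZGradedGraph.Balanced.hasSum_in {G : MeasuredZGradedGraph V} (hG : G.Balanced)
    (x : V) : HasSum (fun y : {y : V // G.graph.Adj y x} => G.μE y x / G.μV x) 1 := by
  simpa [div_self (G.μV_pos x).ne'] using (hG x).2.div_const (G.μV x)

/-- The acceleration at each vertex is Lipschitz on balls of `ℓ^∞`, uniformly in the vertex, since
the balance condition makes it a difference of two averages. -/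
theorem MeasuredZGradedGraph.Balanced.accel_lipschitz {G : MeasuredZGradedGraph V}
    (hG : G.Balanced) (R : ℝ) : ∃ K : ℝ, 0 ≤ K ∧ ∀ p q : EllInf V, ‖p‖ ≤ R → ‖q‖ ≤ R →
      ∀ x, |G.accel todaU p x - G.accel todaU q x| ≤ K * ‖p - q‖ := by
  refine ⟨4 * Real.exp (2 * R), by positivity, fun p q hp hq x => ?_⟩
  have bd : ∀ (r : EllInf V), ‖r‖ ≤ R → ∀ a b : V, -(r a - r b) ≤ 2 * R := fun r hr a b => by
    have h1 := abs_le.1 ((abs_apply_le r a).trans hr)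
    have h2 := abs_le.1 ((abs_apply_le r b).trans hr)
    linarith [h1.1, h2.2]
  have bd1 : ∀ (r : EllInf V), ‖r‖ ≤ R → ∀ a b : V, |deriv todaU (r a - r b)| ≤ Real.exp (2 * R) :=
    fun r hr a b => by
      rw [deriv_todaU, abs_neg, abs_of_pos (Real.exp_pos _)]
      exact Real.exp_le_exp.2 (bd r hr a b)
  have bd2 : ∀ a b : V, |deriv todaU (p a - p b) - deriv todaU (q a - q b)| ≤
      2 * Real.exp (2 * R) * ‖p - q‖ := fun a b => by
    rw [deriv_todaU, deriv_todaU, neg_sub_neg, abs_sub_comm]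
    refine (abs_exp_sub_exp_le (bd p hp a b) (bd q hq a b)).trans ?_
    have h1 := abs_apply_le (p - q) a
    have h2 := abs_apply_le (p - q) b
    simp only [lp.coeFn_sub, Pi.sub_apply] at h1 h2
    have : |-(p a - p b) - -(q a - q b)| ≤ 2 * ‖p - q‖ := by
      rw [abs_le] at h1 h2 ⊢
      constructor <;> linarith [h1.1, h1.2, h2.1, h2.2]
    calc _ ≤ Real.exp (2 * R) * (2 * ‖p - q‖) := by gcongr
      _ = _ := by ring
  have h1 := abs_tsum_weight_mul_sub_le
    (w := fun y : {y : V // G.graph.Adj x y} => G.μE x y / G.μV x)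
    (fun y => (div_pos (G.μE_pos _ _ y.2) (G.μV_pos _)).le) (hG.hasSum_out x)
    (fun y => bd1 p hp y x) (fun y => bd1 q hq y x) (fun y => bd2 y x)
  have h2 := abs_tsum_weight_mul_sub_le
    (w := fun y : {y : V // G.graph.Adj y x} => G.μE y x / G.μV x)
    (fun y => (div_pos (G.μE_pos _ _ y.2) (G.μV_pos _)).le) (hG.hasSum_in x)
    (fun y => bd1 p hp x y) (fun y => bd1 q hq x y) (fun y => bd2 x y)
  rw [MeasuredZGradedGraph.accel, MeasuredZGradedGraph.accel]
  rw [abs_le] at h1 h2 ⊢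
  constructor <;> linarith [h1.1, h1.2, h2.1, h2.2]

/-- The initial value problem on a balanced graph has at most one solution on an interval. -/
theorem MeasuredZGradedGraph.IsSolutionOn.eqOn {G : MeasuredZGradedGraph V} (hG : G.Balanced)
    {I : Set ℝ} (hI : I.OrdConnected) (h0 : (0 : ℝ) ∈ I) {c d : ℝ → Phase V}
    (hc : G.IsSolutionOn todaU c I) (hd : G.IsSolutionOn todaU d I) (h : c 0 = d 0) :
    EqOn c d I := by
  choose! c' hc using hc
  choose! d' hd using hd
  refine eqOn_of_locally_lipschitz hI h0 (fun t ht => (hc t ht).1) (fun t ht => (hd t ht).1) h ?_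
  intro R
  obtain ⟨K, hK0, hK⟩ := hG.accel_lipschitz R
  refine ⟨max 1 K, fun t ht h1 h2 => ?_⟩
  obtain ⟨-, hc1, hc2⟩ := hc t ht
  obtain ⟨-, hd1, hd2⟩ := hd t ht
  have e1 : ‖(c t).1 - (d t).1‖ ≤ ‖c t - d t‖ := norm_fst_le (c t - d t)
  have e2 : ‖(c t).2 - (d t).2‖ ≤ ‖c t - d t‖ := norm_snd_le (c t - d t)
  refine norm_prod_le_iff.2 ⟨?_, ?_⟩
  · rw [Prod.fst_sub, hc1, hd1]
    exact e2.trans (le_mul_of_one_le_left (norm_nonneg _) (le_max_left _ _))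
  · refine norm_le_of_forall_abs_le (by positivity) fun x => ?_
    rw [Prod.snd_sub, lp.coeFn_sub, Pi.sub_apply, hc2, hd2]
    refine (hK _ _ ((norm_fst_le _).trans h1) ((norm_fst_le _).trans h2) x).trans ?_
    exact mul_le_mul (le_max_right _ _) e1 (norm_nonneg _) (by positivity)

theorem MeasuredZGradedGraph.IsSolutionOn.mono {G : MeasuredZGradedGraph V} {U : ℝ → ℝ}
    {c : ℝ → Phase V} {I J : Set ℝ} (h : G.IsSolutionOn U c J) (hIJ : I ⊆ J) :
    G.IsSolutionOn U c I := fun t ht =>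
  let ⟨v, hv, h'⟩ := h t (hIJ ht)
  ⟨v, hv.mono hIJ, h'⟩

/-! ### The chain and radial lifts -/

theorem chain_accel (U : ℝ → ℝ) (q : ℤ → ℝ) (n : ℤ) :
    chain.accel U q n = deriv U (q (n + 1) - q n) - deriv U (q n - q (n - 1)) := by
  have h1 : Unique {y : ℤ // chain.graph.Adj n y} :=
    ⟨⟨⟨n + 1, rfl⟩⟩, fun y => Subtype.ext y.2⟩
  have h2 : Unique {y : ℤ // chain.graph.Adj y n} :=
    ⟨⟨⟨n - 1, (sub_add_cancel n 1).symm⟩⟩, fun y => Subtype.ext (eq_sub_of_add_eq y.2.symm)⟩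
  have e1 : ((default : {y : ℤ // chain.graph.Adj n y}) : ℤ) = n + 1 :=
    (default : {y : ℤ // chain.graph.Adj n y}).2
  have e2 : ((default : {y : ℤ // chain.graph.Adj y n}) : ℤ) = n - 1 :=
    eq_sub_of_add_eq (default : {y : ℤ // chain.graph.Adj y n}).2.symm
  rw [MeasuredZGradedGraph.accel, tsum_fintype, tsum_fintype, Fintype.sum_unique,
    Fintype.sum_unique, e1, e2]
  simp [chain]

theorem chain_balanced : chain.Balanced := fun n => by
  have h1 : Unique {y : ℤ // chain.graph.Adj n y} :=
    ⟨⟨⟨n + 1, rfl⟩⟩, fun y => Subtype.ext y.2⟩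
  have h2 : Unique {y : ℤ // chain.graph.Adj y n} :=
    ⟨⟨⟨n - 1, (sub_add_cancel n 1).symm⟩⟩, fun y => Subtype.ext (eq_sub_of_add_eq y.2.symm)⟩
  exact ⟨hasSum_unique _, hasSum_unique _⟩

/-- On radial functions the acceleration of a balanced graph is that of the chain. -/
theorem MeasuredZGradedGraph.Balanced.accel_radial {G : MeasuredZGradedGraph V} (hG : G.Balanced)
    (U : ℝ → ℝ) (φ : ℤ → ℝ) (x : V) :
    G.accel U (fun y => φ (G.rank y)) x = chain.accel U φ (G.rank x) := by
  rw [chain_accel, MeasuredZGradedGraph.accel]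
  congr 1
  · have : ∀ y : {y : V // G.graph.Adj x y}, G.μE x y / G.μV x *
        deriv U (φ (G.rank y) - φ (G.rank x)) = G.μE x y / G.μV x *
        deriv U (φ (G.rank x + 1) - φ (G.rank x)) := fun y => by rw [G.rank_edge x y y.2]
    simp_rw [this]
    rw [tsum_mul_right, (hG.hasSum_out x).tsum_eq, one_mul]
  · have : ∀ y : {y : V // G.graph.Adj y x}, G.μE y x / G.μV x *
        deriv U (φ (G.rank x) - φ (G.rank y)) = G.μE y x / G.μV x *
        deriv U (φ (G.rank x) - φ (G.rank x - 1)) := fun y => by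
      rw [show G.rank y = G.rank x - 1 from eq_sub_of_add_eq (G.rank_edge y x y.2).symm]
    simp_rw [this]
    rw [tsum_mul_right, (hG.hasSum_in x).tsum_eq, one_mul]

/-- The radial lift as a continuous linear map of phase spaces. -/
noncomputable def ZGradedGraph.liftCLM (G : ZGradedGraph V) : Phase ℤ →L[ℝ] Phase V :=
  LinearMap.mkContinuous
    { toFun := G.lift
      map_add' := fun _ _ => rfl
      map_smul' := fun _ _ => rfl } 1 fun z => by
    have key : ∀ φ : EllInf ℤ, ‖G.pullback φ‖ ≤ ‖φ‖ := fun φ =>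
      norm_le_of_forall_abs_le (norm_nonneg _) fun x => abs_apply_le φ (G.rank x)
    rw [one_mul]
    exact norm_prod_le_iff.2 ⟨(key _).trans (norm_fst_le z), (key _).trans (norm_snd_le z)⟩

/-- The radial lift of a solution of the chain is a solution on the graph. -/
theorem MeasuredZGradedGraph.Balanced.lift_isSolutionOn {G : MeasuredZGradedGraph V}
    (hG : G.Balanced) {U : ℝ → ℝ} {c : ℝ → Phase ℤ} {I : Set ℝ} (hc : chain.IsSolutionOn U c I) :
    G.IsSolutionOn U (fun t => G.lift (c t)) I := by
  intro t ht
  obtain ⟨v, hv, hv1, hv2⟩ := hc t ht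
  refine ⟨G.lift v, ?_, ?_, fun x => ?_⟩
  · exact G.liftCLM.hasFDerivAt.comp_hasDerivWithinAt t hv
  · exact congrArg G.pullback hv1
  · exact (hv2 (G.rank x)).trans (hG.accel_radial U (fun n => (c t).1 n) x).symm

/-! ### Continuation of integral curves -/

section Continuation

variable {E : Type*} [NormedAddCommGroup E] [NormedSpace ℝ E]

theorem glue_integralCurve {X : E → E} {f g : ℝ → E} {a b c : ℝ} (hab : a ≤ b) (hbc : b ≤ c)
    (hf : ∀ t ∈ Icc a b, HasDerivWithinAt f (X (f t)) (Icc a b) t)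
    (hg : ∀ t ∈ Icc b c, HasDerivWithinAt g (X (g t)) (Icc b c) t) (h : f b = g b) :
    ∃ k : ℝ → E, (∀ t ∈ Icc a b, k t = f t) ∧ (∀ t ∈ Icc b c, k t = g t) ∧
      ∀ t ∈ Icc a c, HasDerivWithinAt k (X (k t)) (Icc a c) t := by
  have h1 : ∀ t ∈ Icc a b, (if t ≤ b then f t else g t) = f t := fun t ht => if_pos ht.2
  have h2 : ∀ t ∈ Icc b c, (if t ≤ b then f t else g t) = g t := fun t ht => by
    split_ifs with htb
    · rw [le_antisymm htb ht.1, h]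
    · rfl
  refine ⟨fun t => if t ≤ b then f t else g t, h1, h2, fun t ht => ?_⟩
  rw [← Icc_union_Icc_eq_Icc hab hbc]
  refine HasDerivWithinAt.union ?_ ?_
  · by_cases htb : t ∈ Icc a b
    · have := (hf t htb).congr h1 (h1 t htb)
      simpa only [h1 t htb] using this
    · exact HasFDerivWithinAt.of_notMem_closure (by rwa [isClosed_Icc.closure_eq])
  · by_cases htb : t ∈ Icc b c
    · have := (hg t htb).congr h2 (h2 t htb)
      simpa only [h2 t htb] using this
    · exact HasFDerivWithinAt.of_notMem_closure (by rwa [isClosed_Icc.closure_eq])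

/-- A vector field that is Lipschitz on balls has integral curves through all points of a given
ball whose time of existence is bounded below. -/
theorem exists_uniform_time [CompleteSpace E] {X : E → E}
    (hX : ∀ R : ℝ, ∃ K : NNReal, LipschitzOnWith K X (Metric.closedBall 0 R)) (R : ℝ) :
    ∃ ε > 0, ∀ x : E, ‖x‖ ≤ R → ∃ α : ℝ → E, α 0 = x ∧
      ∀ t ∈ Icc (-ε) ε, HasDerivWithinAt α (X (α t)) (Icc (-ε) ε) t := by
  obtain ⟨K, hK⟩ := hX (R + 1)
  obtain ⟨L, hL⟩ : ∃ L : NNReal, ∀ y ∈ Metric.closedBall (0 : E) (R + 1), ‖X y‖ ≤ L := by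
    refine ⟨K * (R + 1).toNNReal + ‖X 0‖₊, fun y hy => ?_⟩
    have hy' := mem_closedBall_zero_iff.1 hy
    have hR : 0 ≤ R + 1 := (norm_nonneg _).trans hy'
    have h1 := hK.norm_sub_le hy (Metric.mem_closedBall_self hR)
    have h2 := norm_sub_norm_le (X y) (X 0)
    rw [sub_zero] at h1
    have h3 : (K : ℝ) * ‖y‖ ≤ K * (R + 1) := by gcongr
    push_cast
    rw [Real.coe_toNNReal _ hR]
    linarith
  have hε : (0 : ℝ) < 1 / (L + 1) := by positivity
  -- within time `1 / (L + 1)` a curve of speed at most `L` stays in the unit ball around its origin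
  refine ⟨1 / (L + 1), hε, fun x hx => ?_⟩
  have hsub : Metric.closedBall x ((1 : NNReal) : ℝ) ⊆ Metric.closedBall 0 (R + 1) := by
    refine Metric.closedBall_subset_closedBall' ?_
    rw [dist_zero_right, NNReal.coe_one]
    linarith
  have hp : IsPicardLindelof (fun _ : ℝ => X)
      (tmin := -(1 / ((L : ℝ) + 1))) (tmax := 1 / ((L : ℝ) + 1))
      ⟨0, by constructor <;> linarith⟩ x 1 0 L K := by
    refine IsPicardLindelof.of_time_independent (fun y hy => hL y (hsub hy)) (hK.mono hsub) ?_
    simp only [sub_zero, zero_sub, neg_neg, max_self, NNReal.coe_one, NNReal.coe_zero]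
    rw [mul_one_div, div_le_one (by positivity)]
    linarith
  exact hp.exists_eq_forall_mem_Icc_hasDerivWithinAt₀

theorem integralCurve_shift {X : E → E} {α : ℝ → E} {a b : ℝ} (s : ℝ)
    (hα : ∀ t ∈ Icc a b, HasDerivWithinAt α (X (α t)) (Icc a b) t) :
    ∀ t ∈ Icc (a + s) (b + s),
      HasDerivWithinAt (fun r => α (r - s)) (X (α (t - s))) (Icc (a + s) (b + s)) t := by
  intro t ht
  have hm : MapsTo (fun r => r - s) (Icc (a + s) (b + s)) (Icc a b) := fun r hr =>
    ⟨by linarith [hr.1], by linarith [hr.2]⟩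
  have := (hα (t - s) (hm ht)).scomp t ((hasDerivAt_id t).sub_const s).hasDerivWithinAt hm
  simpa [Function.comp_def] using this

/-- A vector field that is Lipschitz on balls has an integral curve on `[-T, T]` through a point
for which all such curves on shorter intervals obey an a priori bound at their endpoints. -/
theorem exists_integralCurve_of_apriori [CompleteSpace E] {X : E → E}
    (hX : ∀ R : ℝ, ∃ K : NNReal, LipschitzOnWith K X (Metric.closedBall 0 R)) {x₀ : E} {T R : ℝ}
    (hT : 0 ≤ T)
    (hR : ∀ s ∈ Icc 0 T, ∀ γ : ℝ → E, γ 0 = x₀ →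
      (∀ t ∈ Icc (-s) s, HasDerivWithinAt γ (X (γ t)) (Icc (-s) s) t) → ‖γ s‖ ≤ R ∧ ‖γ (-s)‖ ≤ R) :
    ∃ γ : ℝ → E, γ 0 = x₀ ∧ ∀ t ∈ Icc (-T) T, HasDerivWithinAt γ (X (γ t)) (Icc (-T) T) t := by
  obtain ⟨ε, hε, hloc⟩ := exists_uniform_time hX R
  -- extend the curve at both ends by the uniform time `ε`, until `T` is reached
  have key : ∀ n : ℕ, ∃ γ : ℝ → E, γ 0 = x₀ ∧ ∀ t ∈ Icc (-min (n * ε) T) (min (n * ε) T),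
      HasDerivWithinAt γ (X (γ t)) (Icc (-min (n * ε) T) (min (n * ε) T)) t := by
    intro n
    induction n with
    | zero =>
      refine ⟨fun _ => x₀, rfl, fun t ht => ?_⟩
      have : min (((0 : ℕ) : ℝ) * ε) T = 0 := by simp [hT]
      rw [this, neg_zero, Icc_self] at ht ⊢
      rw [mem_singleton_iff.1 ht]
      exact HasFDerivWithinAt.of_finite (finite_singleton 0)
    | succ n ih =>
      obtain ⟨γ, h0, hγ⟩ := ih
      set s := min (n * ε) T with hs
      set s' := min ((n + 1 : ℕ) * ε) T with hs'
      have hs0 : 0 ≤ s := le_min (by positivity) hT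
      have hss' : s ≤ s' := min_le_min_right _ (by push_cast; nlinarith)
      have hs'ε : s' ≤ s + ε := by
        rw [hs, hs', ← min_add_add_right]
        exact min_le_min (by push_cast; linarith) (by linarith)
      obtain ⟨hb1, hb2⟩ := hR s ⟨hs0, min_le_right _ _⟩ γ h0 hγ
      obtain ⟨α, hα0, hα⟩ := hloc _ hb1
      obtain ⟨β, hβ0, hβ⟩ := hloc _ hb2
      have hα' := integralCurve_shift s hα
      have hβ' := integralCurve_shift (-s) hβ
      have sub1 : Icc s s' ⊆ Icc (-ε + s) (ε + s) := Icc_subset_Icc (by linarith) (by linarith)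
      have sub2 : Icc (-s') (-s) ⊆ Icc (-ε + -s) (ε + -s) :=
        Icc_subset_Icc (by linarith) (by linarith)
      obtain ⟨k, hk1, -, hk⟩ := glue_integralCurve (X := X) (f := γ) (g := fun r => α (r - s))
        (by linarith : -s ≤ s) hss' hγ (fun t ht => (hα' t (sub1 ht)).mono sub1)
        (by simp [hα0])
      obtain ⟨l, -, hl2, hl⟩ := glue_integralCurve (X := X) (f := fun r => β (r - -s)) (g := k)
        (neg_le_neg hss') (by linarith : -s ≤ s') (fun t ht => (hβ' t (sub2 ht)).mono sub2) hk
        (by simp [hβ0, hk1 (-s) ⟨le_rfl, by linarith⟩])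
      refine ⟨l, ?_, hl⟩
      rw [hl2 0 ⟨by linarith, by linarith⟩, hk1 0 ⟨by linarith, by linarith⟩, h0]
  obtain ⟨n, hn⟩ := exists_nat_gt (T / ε)
  have : min (n * ε) T = T := min_eq_right ((div_lt_iff₀ hε).1 hn).le
  simpa only [this] using key n

end Continuation

/-! ### Isospectral flows -/

/-- A Lax equation `L' = [P, L]` with `P` skew-adjoint preserves the norm of `L`: to first order in
`h`, `L (t + h)` is the unitary conjugate `exp (hP) L(t) exp (-hP)`. -/
theorem norm_eq_of_lax {A : Type*} [NormedRing A] [StarRing A] [CStarRing A] [NormedAlgebra ℝ A]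
    [CompleteSpace A] {L P : ℝ → A} {I : Set ℝ} (hI : Convex ℝ I)
    (hL : ∀ t ∈ I, HasDerivWithinAt L (P t * L t - L t * P t) I t)
    (hP : ∀ t ∈ I, P t ∈ skewAdjoint A) {s t : ℝ} (hs : s ∈ I) (ht : t ∈ I) : ‖L s‖ = ‖L t‖ := by
  let _ : NormedAlgebra ℚ A := NormedAlgebra.restrictScalars ℚ ℝ A
  have key : ∀ t ∈ I, HasDerivWithinAt (fun s => ‖L s‖) 0 I t := by
    intro t ht
    set f : ℝ → A := fun s =>
      NormedSpace.exp ((s - t) • P t) * L t * NormedSpace.exp (-((s - t) • P t))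
      with hf
    have hft : f t = L t := by simp [hf]
    have hid : HasDerivAt (fun s : ℝ => s - t) 1 t := (hasDerivAt_id t).sub_const t
    have hexp : ∀ Q : A, HasDerivAt (fun s : ℝ => NormedSpace.exp ((s - t) • Q)) Q t := fun Q => by
      have := HasDerivAt.scomp t (h := fun s : ℝ => s - t)
        (hasDerivAt_exp_smul_const (𝕂 := ℝ) Q (t - t)) hid
      exact this.congr_deriv (by simp)
    have hexp' : HasDerivAt (fun s : ℝ => NormedSpace.exp (-((s - t) • P t))) (-P t) t := by
      simpa only [smul_neg] using hexp (-P t)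
    have hfd : HasDerivAt f (P t * L t - L t * P t) t :=
      (((hexp (P t)).mul_const (L t)).mul hexp').congr_deriv (by simp [sub_eq_add_neg])
    have hnorm : ∀ s, ‖f s‖ = ‖L t‖ := by
      intro s
      have hsk : (s - t) • P t ∈ skewAdjoint A := by
        have hP' : star (P t) = -P t := skewAdjoint.mem_iff.1 (hP t ht)
        have : star ((s - t) • P t) = (s - t) • star (P t) :=
          map_real_smul (starAddEquiv : A ≃+ A) continuous_star (s - t) (P t)
        rw [skewAdjoint.mem_iff, this, hP', smul_neg]
      have h1 := NormedSpace.exp_mem_unitary_of_mem_skewAdjoint hsk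
      have h2 := NormedSpace.exp_mem_unitary_of_mem_skewAdjoint (neg_mem hsk)
      rw [hf]
      simp only
      rw [CStarRing.norm_mul_mem_unitary _ h2, CStarRing.norm_mem_unitary_mul _ h1]
    -- so the norms of `L s` and `L t` differ by `o(s - t)`
    have hd : HasDerivWithinAt (fun s => L s - f s) 0 I t :=
      ((hL t ht).sub hfd.hasDerivWithinAt).congr_deriv (sub_self _)
    rw [hasDerivWithinAt_iff_isLittleO] at hd ⊢
    refine Asymptotics.IsBigO.trans_isLittleO
      (Asymptotics.IsBigO.of_bound 1 (Eventually.of_forall fun s => ?_)) hd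
    simp only [hft, sub_self, smul_zero, sub_zero, one_mul]
    rw [← hnorm s]
    exact abs_norm_sub_norm_le _ _
  refine hI.is_const_of_fderivWithin_eq_zero (𝕜 := ℝ) (f := fun s => ‖L s‖)
    (fun r hr => (key r hr).differentiableWithinAt) (fun r hr => ?_) hs ht
  -- `fderivWithin` is zero by convention where derivatives within `I` are not unique
  by_cases hu : UniqueDiffWithinAt ℝ I r
  · have := (key r hr).hasFDerivWithinAt.fderivWithin hu
    rw [this]
    ext
    simp
  · exact fderivWithin_zero_of_not_uniqueDiffWithinAt hu

/-! ### Shifts and multiplication operators -/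

/-- The shift `φ ↦ φ (· + k)` on bounded functions on `ℤ`. -/
noncomputable def shiftInf (k : ℤ) : EllInf ℤ →L[ℝ] EllInf ℤ :=
  LinearMap.mkContinuous
    { toFun := fun φ => ⟨fun n => φ (n + k), memℓp_infty ⟨‖φ‖, by
        rintro _ ⟨n, rfl⟩
        exact abs_apply_le φ (n + k)⟩⟩
      map_add' := fun _ _ => rfl
      map_smul' := fun _ _ => rfl } 1 fun φ => by
    rw [one_mul]
    exact norm_le_of_forall_abs_le (norm_nonneg _) fun n => abs_apply_le φ (n + k)

@[simp] theorem shiftInf_apply (k : ℤ) (φ : EllInf ℤ) (n : ℤ) : shiftInf k φ n = φ (n + k) := rfl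

/-- The Hilbert space `ℓ²(ℤ)`. -/
abbrev EllTwo : Type := lp (fun _ : ℤ => ℝ) 2

/-- The shift `f ↦ f (· + k)` on `ℓ²(ℤ)`. -/
noncomputable def shiftTwo (k : ℤ) : EllTwo →L[ℝ] EllTwo :=
  LinearMap.mkContinuous
    { toFun := fun f => ⟨fun n => f (n + k), by
        have h := (lp.memℓp f).summable (by simp)
        exact memℓp_gen ((Equiv.addRight k).summable_iff.2 h)⟩
      map_add' := fun _ _ => rfl
      map_smul' := fun _ _ => rfl } 1 fun f => by
    rw [one_mul, lp.norm_eq_tsum_rpow (by simp), lp.norm_eq_tsum_rpow (by simp)]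
    exact (congrArg (· ^ (1 / (2 : ℝ≥0∞).toReal))
      ((Equiv.addRight k).tsum_eq fun n => ‖f n‖ ^ (2 : ℝ≥0∞).toReal)).le

@[simp] theorem shiftTwo_apply (k : ℤ) (f : EllTwo) (n : ℤ) : shiftTwo k f n = f (n + k) := rfl

theorem star_shiftTwo (k : ℤ) : star (shiftTwo k) = shiftTwo (-k) := by
  rw [ContinuousLinearMap.star_eq_adjoint]
  refine (ContinuousLinearMap.eq_adjoint_iff _ _).2 (fun f g => ?_) |>.symm
  rw [lp.inner_eq_tsum, lp.inner_eq_tsum, ← (Equiv.addRight k).tsum_eq]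
  simp

/-- Multiplication by a bounded function, as an operator on `ℓ²(ℤ)`. -/
noncomputable def mulOp : EllInf ℤ →L[ℝ] EllTwo →L[ℝ] EllTwo :=
  lp.holderL 2 (fun _ => ContinuousLinearMap.mul ℝ ℝ) (K := 1) fun _ =>
    ContinuousLinearMap.opNorm_mul_le ℝ ℝ

@[simp] theorem mulOp_apply (φ : EllInf ℤ) (f : EllTwo) (n : ℤ) : mulOp φ f n = φ n * f n := rfl

theorem star_mulOp (φ : EllInf ℤ) : star (mulOp φ) = mulOp φ := by
  rw [ContinuousLinearMap.star_eq_adjoint]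
  refine (ContinuousLinearMap.eq_adjoint_iff _ _).2 (fun f g => ?_) |>.symm
  rw [lp.inner_eq_tsum, lp.inner_eq_tsum]
  refine tsum_congr fun n => ?_
  simp
  ring

/-! ### The Lax pair -/

/-- The Jacobi operator with off-diagonal coefficients `a` and diagonal coefficients `b`. -/
noncomputable def laxL (a b : EllInf ℤ) : EllTwo →L[ℝ] EllTwo :=
  mulOp a * shiftTwo 1 + shiftTwo (-1) * mulOp a + mulOp b

/-- The skew-adjoint partner of the Jacobi operator in the Lax pair. -/
noncomputable def laxP (a : EllInf ℤ) : EllTwo →L[ℝ] EllTwo :=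
  mulOp a * shiftTwo 1 - shiftTwo (-1) * mulOp a

theorem laxL_apply (a b : EllInf ℤ) (f : EllTwo) (n : ℤ) :
    laxL a b f n = a n * f (n + 1) + a (n + -1) * f (n + -1) + b n * f n := rfl

theorem laxP_apply (a : EllInf ℤ) (f : EllTwo) (n : ℤ) :
    laxP a f n = a n * f (n + 1) - a (n + -1) * f (n + -1) := rfl

theorem laxP_mem_skewAdjoint (a : EllInf ℤ) : laxP a ∈ skewAdjoint (EllTwo →L[ℝ] EllTwo) := by
  rw [skewAdjoint.mem_iff, laxP, star_sub, star_mul, star_mul, star_mulOp, star_shiftTwo,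
    star_shiftTwo, neg_neg, neg_sub]

theorem lax_commutator (a b : EllInf ℤ) :
    laxP a * laxL a b - laxL a b * laxP a =
      laxL (a * (shiftInf 1 b - b)) ((2 : ℝ) • (a * a - shiftInf (-1) (a * a))) := by
  ext f n
  have h : ((laxP a * laxL a b - laxL a b * laxP a) f) n =
      laxP a (laxL a b f) n - laxL a b (laxP a f) n := rfl
  rw [h]
  simp only [laxL_apply, laxP_apply, lp.infty_coeFn_mul, lp.coeFn_smul, lp.coeFn_sub, Pi.mul_apply,
    Pi.sub_apply, Pi.smul_apply, shiftInf_apply, smul_eq_mul, neg_add_cancel_right,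
    add_neg_cancel_right]
  ring

theorem norm_le_norm_laxL (a b : EllInf ℤ) : ‖b‖ ≤ ‖laxL a b‖ := by
  refine norm_le_of_forall_abs_le (norm_nonneg _) fun n => ?_
  have h1 : laxL a b (lp.single 2 n 1) n = b n := by
    simp [laxL]
  have h2 : ‖laxL a b (lp.single 2 n 1) n‖ ≤ ‖laxL a b (lp.single 2 n 1)‖ :=
    lp.norm_apply_le_norm (by simp) _ n
  have h3 := (laxL a b).le_opNorm (lp.single 2 n (1 : ℝ))
  rw [lp.norm_single (by simp), norm_one, mul_one] at h3
  rw [← Real.norm_eq_abs, ← h1]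
  exact h2.trans h3

/-! ### Global solutions of the chain -/

theorem exp_apply (φ : EllInf ℤ) (n : ℤ) : NormedSpace.exp φ n = Real.exp (φ n) := by
  let _ : NormedAlgebra ℚ (EllInf ℤ) := NormedAlgebra.restrictScalars ℚ ℝ (EllInf ℤ)
  let ev : EllInf ℤ →+* ℝ :=
    { toFun := fun φ => φ n
      map_one' := rfl
      map_mul' := fun _ _ => rfl
      map_zero' := rfl
      map_add' := fun _ _ => rfl }
  rw [Real.exp_eq_exp_ℝ]
  exact NormedSpace.map_exp ev (lp.evalCLM ℝ (fun _ : ℤ => ℝ) ∞ n).continuous φ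

/-- The force of the Toda chain, as a nonlinear operator on `ℓ^∞(ℤ)`; the exponentials are taken in
this Banach algebra. -/
noncomputable def chainForce (q : EllInf ℤ) : EllInf ℤ :=
  NormedSpace.exp (shiftInf (-1) q - q) - NormedSpace.exp (q - shiftInf 1 q)

theorem chain_accel_todaU (q : ℤ → ℝ) (n : ℤ) :
    chain.accel todaU q n = Real.exp (q (n - 1) - q n) - Real.exp (q n - q (n + 1)) := by
  rw [chain_accel, deriv_todaU, deriv_todaU, neg_sub, neg_sub]
  ring

theorem chainForce_apply (q : EllInf ℤ) (n : ℤ) : chainForce q n = chain.accel todaU q n := by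
  rw [chain_accel_todaU]
  simp only [chainForce, lp.coeFn_sub, Pi.sub_apply, exp_apply, shiftInf_apply]
  rfl

/-- The Hamiltonian vector field of the Toda chain. -/
noncomputable def chainField (z : Phase ℤ) : Phase ℤ := (z.2, chainForce z.1)

theorem chain_isSolutionOn_iff {c : ℝ → Phase ℤ} {I : Set ℝ} :
    chain.IsSolutionOn todaU c I ↔ ∀ t ∈ I, HasDerivWithinAt c (chainField (c t)) I t := by
  refine forall₂_congr fun t _ => ⟨?_, fun h => ⟨_, h, rfl, fun x => chainForce_apply _ x⟩⟩
  rintro ⟨v, hv, h1, h2⟩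
  have : v = chainField (c t) := Prod.ext h1 (by
    ext n
    exact (h2 n).trans (chainForce_apply _ n).symm)
  rwa [← this]

theorem chainField_lipschitzOn (R : ℝ) :
    ∃ K : NNReal, LipschitzOnWith K chainField (Metric.closedBall 0 R) := by
  obtain ⟨K, hK0, hK⟩ := chain_balanced.accel_lipschitz R
  refine ⟨max 1 K.toNNReal, LipschitzOnWith.of_dist_le_mul fun x hx y hy => ?_⟩
  rw [mem_closedBall_zero_iff] at hx hy
  rw [dist_eq_norm, dist_eq_norm, NNReal.coe_max, NNReal.coe_one, Real.coe_toNNReal _ hK0]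
  have e1 : ‖x.1 - y.1‖ ≤ ‖x - y‖ := norm_fst_le (x - y)
  have e2 : ‖x.2 - y.2‖ ≤ ‖x - y‖ := norm_snd_le (x - y)
  refine norm_prod_le_iff.2 ⟨?_, ?_⟩
  · exact e2.trans (le_mul_of_one_le_left (norm_nonneg _) (le_max_left _ _))
  · refine norm_le_of_forall_abs_le (by positivity) fun n => ?_
    change |(chainForce x.1 - chainForce y.1) n| ≤ _
    rw [lp.coeFn_sub, Pi.sub_apply, chainForce_apply, chainForce_apply]
    refine (hK _ _ ((norm_fst_le _).trans hx) ((norm_fst_le _).trans hy) n).trans ?_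
    exact mul_le_mul (le_max_right _ _) e1 (norm_nonneg _) (by positivity)

/-- The off-diagonal Flaschka variable `a = exp ((q - q(· + 1)) / 2) / 2`. -/
noncomputable def flaschkaA (z : Phase ℤ) : EllInf ℤ :=
  (1 / 2 : ℝ) • NormedSpace.exp ((1 / 2 : ℝ) • (z.1 - shiftInf 1 z.1))

/-- The diagonal Flaschka variable `b = -q̇ / 2`. -/
noncomputable def flaschkaB (z : Phase ℤ) : EllInf ℤ := (-(1 / 2) : ℝ) • z.2

theorem hasDerivWithinAt_flaschkaA {c : ℝ → Phase ℤ} {I : Set ℝ} {t : ℝ}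
    (h : HasDerivWithinAt c (chainField (c t)) I t) :
    HasDerivWithinAt (fun s => flaschkaA (c s))
      (flaschkaA (c t) * (shiftInf 1 (flaschkaB (c t)) - flaschkaB (c t))) I t := by
  have hq : HasDerivWithinAt (fun s => (c s).1) (c t).2 I t := h.fst
  have hS := (shiftInf 1).hasFDerivAt.comp_hasDerivWithinAt t hq
  have hr := (hq.sub hS).const_smul (1 / 2 : ℝ)
  have he := (hasStrictFDerivAt_exp (𝕂 := ℝ)
    (x := (1 / 2 : ℝ) • ((c t).1 - shiftInf 1 (c t).1))).hasFDerivAt.comp_hasDerivWithinAt t hr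
  refine (he.const_smul (1 / 2 : ℝ)).congr_deriv ?_
  change (1 / 2 : ℝ) • (NormedSpace.exp ((1 / 2 : ℝ) • ((c t).1 - shiftInf 1 (c t).1)) *
    ((1 / 2 : ℝ) • ((c t).2 - shiftInf 1 (c t).2))) = _
  ext n
  simp only [flaschkaA, flaschkaB, lp.coeFn_smul, lp.coeFn_sub, lp.infty_coeFn_mul, Pi.mul_apply,
    Pi.smul_apply, Pi.sub_apply, shiftInf_apply, smul_eq_mul]
  ring

theorem hasDerivWithinAt_flaschkaB {c : ℝ → Phase ℤ} {I : Set ℝ} {t : ℝ}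
    (h : HasDerivWithinAt c (chainField (c t)) I t) :
    HasDerivWithinAt (fun s => flaschkaB (c s)) ((2 : ℝ) • (flaschkaA (c t) * flaschkaA (c t) -
      shiftInf (-1) (flaschkaA (c t) * flaschkaA (c t)))) I t := by
  have hv : HasDerivWithinAt (fun s => (c s).2) (chainForce (c t).1) I t := h.snd
  refine (hv.const_smul (-(1 / 2) : ℝ)).congr_deriv ?_
  have sq : ∀ x : ℝ, Real.exp (1 / 2 * x) * Real.exp (1 / 2 * x) = Real.exp x := fun x => by
    rw [← Real.exp_add]
    ring_nf
  ext n
  have e : n + -1 + 1 = n := by ring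
  simp only [flaschkaA, chainForce, lp.coeFn_smul, lp.coeFn_sub, lp.infty_coeFn_mul, Pi.mul_apply,
    Pi.smul_apply, Pi.sub_apply, shiftInf_apply, exp_apply, smul_eq_mul, e]
  rw [mul_mul_mul_comm, sq, mul_mul_mul_comm, sq]
  ring

/-- Along a solution of the chain the Jacobi operator satisfies a Lax equation. -/
theorem hasDerivWithinAt_laxL {c : ℝ → Phase ℤ} {I : Set ℝ} {t : ℝ}
    (h : HasDerivWithinAt c (chainField (c t)) I t) :
    HasDerivWithinAt (fun s => laxL (flaschkaA (c s)) (flaschkaB (c s)))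
      (laxP (flaschkaA (c t)) * laxL (flaschkaA (c t)) (flaschkaB (c t)) -
        laxL (flaschkaA (c t)) (flaschkaB (c t)) * laxP (flaschkaA (c t))) I t := by
  rw [lax_commutator]
  have ha := mulOp.hasFDerivAt.comp_hasDerivWithinAt t (hasDerivWithinAt_flaschkaA h)
  have hb := mulOp.hasFDerivAt.comp_hasDerivWithinAt t (hasDerivWithinAt_flaschkaB h)
  exact ((ha.mul_const (shiftTwo 1)).add (ha.const_mul (shiftTwo (-1)))).add hb

/-- Conservation of the norm of the Jacobi operator bounds the velocities for all time; the
displacements then grow at most linearly. -/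
theorem chain_apriori (z₀ : Phase ℤ) {T s : ℝ} (hs : s ∈ Icc 0 T) {γ : ℝ → Phase ℤ} (h0 : γ 0 = z₀)
    (hγ : ∀ t ∈ Icc (-s) s, HasDerivWithinAt γ (chainField (γ t)) (Icc (-s) s) t) {t : ℝ}
    (ht : t ∈ Icc (-s) s) :
    ‖γ t‖ ≤ ‖z₀‖ + 2 * ‖laxL (flaschkaA z₀) (flaschkaB z₀)‖ * (T + 1) := by
  set M := 2 * ‖laxL (flaschkaA z₀) (flaschkaB z₀)‖ with hM
  have hM0 : 0 ≤ M := by positivity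
  have h0mem : (0 : ℝ) ∈ Icc (-s) s := ⟨by linarith [hs.1], hs.1⟩
  have hv : ∀ r ∈ Icc (-s) s, ‖(γ r).2‖ ≤ M := by
    intro r hr
    have h1 := norm_eq_of_lax (convex_Icc (-s) s) (fun u hu => hasDerivWithinAt_laxL (hγ u hu))
      (fun u _ => laxP_mem_skewAdjoint _) hr h0mem
    have h2 := norm_le_norm_laxL (flaschkaA (γ r)) (flaschkaB (γ r))
    rw [h1, h0, flaschkaB, norm_smul, norm_neg, Real.norm_of_nonneg (by norm_num)] at h2
    linarith
  have hq : ‖(γ t).1 - (γ 0).1‖ ≤ M * ‖t - 0‖ :=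
    (convex_Icc (-s) s).norm_image_sub_le_of_norm_hasDerivWithin_le
      (f := fun r => (γ r).1) (f' := fun r => (γ r).2) (fun r hr => (hγ r hr).fst) hv h0mem ht
  have habs : ‖t - 0‖ ≤ T := by
    rw [sub_zero, Real.norm_eq_abs, abs_le]
    constructor <;> linarith [ht.1, ht.2, hs.2]
  have hT : 0 ≤ T := hs.1.trans hs.2
  have hq' := norm_le_norm_add_norm_sub' (γ t).1 (γ 0).1
  rw [h0] at hq' hq
  have hz : ‖z₀.1‖ ≤ ‖z₀‖ := norm_fst_le z₀
  have hMT : M * ‖t - 0‖ ≤ M * T := by gcongr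
  refine norm_prod_le_iff.2 ⟨by linarith, (hv t ht).trans ?_⟩
  nlinarith [norm_nonneg z₀, mul_nonneg hM0 hT]

theorem exists_chain_solution (z₀ : Phase ℤ) :
    ∃ c : ℝ → Phase ℤ, c 0 = z₀ ∧ chain.IsSolutionOn todaU c univ := by
  have hex : ∀ T : ℝ, ∃ γ : ℝ → Phase ℤ, γ 0 = z₀ ∧
      (0 ≤ T → ∀ t ∈ Icc (-T) T, HasDerivWithinAt γ (chainField (γ t)) (Icc (-T) T) t) := by
    intro T
    by_cases hT : 0 ≤ T
    · obtain ⟨γ, h0, hγ⟩ := exists_integralCurve_of_apriori chainField_lipschitzOn hT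
        (fun s hs γ h0 hγ =>
          ⟨chain_apriori z₀ hs h0 hγ ⟨by linarith [hs.1], le_rfl⟩,
            chain_apriori z₀ hs h0 hγ ⟨le_rfl, by linarith [hs.1]⟩⟩)
      exact ⟨γ, h0, fun _ => hγ⟩
    · exact ⟨fun _ => z₀, rfl, fun h => absurd h hT⟩
  choose γ h0 hγ using hex
  -- two of these curves agree on the smaller of their intervals
  have hcompat : ∀ S T : ℝ, 0 ≤ S → S ≤ T → EqOn (γ S) (γ T) (Icc (-S) S) := by
    intro S T hS hST
    have hsub : Icc (-S) S ⊆ Icc (-T) T := Icc_subset_Icc (neg_le_neg hST) hST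
    refine MeasuredZGradedGraph.IsSolutionOn.eqOn chain_balanced ordConnected_Icc
      ⟨by linarith, hS⟩ (chain_isSolutionOn_iff.2 (hγ S hS))
      (chain_isSolutionOn_iff.2 fun t ht => ?_) ((h0 S).trans (h0 T).symm)
    exact (hγ T (hS.trans hST) t (hsub ht)).mono hsub
  refine ⟨fun t => γ |t| t, h0 _, chain_isSolutionOn_iff.2 fun t _ => ?_⟩
  set T := |t| + 1 with hT
  have hT0 : 0 ≤ T := by positivity
  have heq : ∀ s ∈ Icc (-T) T, γ |s| s = γ T s := fun s hs =>
    hcompat |s| T (abs_nonneg s) (abs_le.2 hs) ⟨neg_abs_le s, le_abs_self s⟩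
  have ht : t ∈ Ioo (-T) T := abs_lt.1 (lt_add_one |t|)
  have h1 := ((hγ T hT0 t (Ioo_subset_Icc_self ht)).congr heq (heq t (Ioo_subset_Icc_self ht)))
  rw [← heq t (Ioo_subset_Icc_self ht)] at h1
  exact (h1.hasDerivAt (Icc_mem_nhds ht.1 ht.2)).hasDerivWithinAt

open Matrix

section MatrixCalculus

variable {ι : Type*} [Fintype ι] [DecidableEq ι]

/-! ### Derivatives of determinants and inverses -/

/-- Jacobi's formula for the derivative of a determinant. -/
theorem hasDerivAt_det {A : ℝ → Matrix ι ι ℝ} {A' : Matrix ι ι ℝ} {t : ℝ}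
    (hA : ∀ i j, HasDerivAt (fun s => A s i j) (A' i j) t) :
    HasDerivAt (fun s => (A s).det) ((A t).adjugate * A').trace t := by
  have h : HasDerivAt (fun s => (A s).det) (∑ σ : Equiv.Perm ι, (Equiv.Perm.sign σ : ℤ) •
      ∑ i, (∏ j ∈ Finset.univ.erase i, A t (σ j) j) • A' (σ i) i) t := by
    simp only [Matrix.det_apply]
    exact HasDerivAt.fun_sum fun σ _ =>
      (HasDerivAt.fun_finsetProd fun i _ => hA (σ i) i).const_smul (Equiv.Perm.sign σ : ℤ)
  refine h.congr_deriv ?_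
  have hdet : ∀ i, ((A t).adjugate * A') i i =
      ((A t).updateCol i fun k => A' k i).det := fun i => by
    rw [← Matrix.cramer_apply, Matrix.cramer_eq_adjugate_mulVec]
    rfl
  simp only [Matrix.trace, Matrix.diag_apply, hdet, Matrix.det_apply, Finset.smul_sum]
  rw [Finset.sum_comm]
  refine Finset.sum_congr rfl fun i _ => Finset.sum_congr rfl fun σ _ => ?_
  rw [← Finset.mul_prod_erase _ _ (Finset.mem_univ i), Matrix.updateCol_self, smul_eq_mul, mul_comm]
  congr 2
  refine Finset.prod_congr rfl fun j hj => ?_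
  rw [Matrix.updateCol_ne (Finset.ne_of_mem_erase hj)]

theorem hasDerivAt_matrix_inv {A : ℝ → Matrix ι ι ℝ} {A' : Matrix ι ι ℝ} {t : ℝ}
    (hA : ∀ i j, HasDerivAt (fun s => A s i j) (A' i j) t) (hu : ∀ s, (A s).det ≠ 0) (i j : ι) :
    HasDerivAt (fun s => (A s)⁻¹ i j) ((-((A t)⁻¹ * A' * (A t)⁻¹)) i j) t := by
  -- the entries of the inverse are differentiable by Cramer's rule
  have hdiff : ∀ i j, ∃ d, HasDerivAt (fun s => (A s)⁻¹ i j) d t := by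
    intro i j
    have h1 := (hasDerivAt_det hA).inv (hu t)
    have h2 : HasDerivAt (fun s => ((A s).updateRow j (Pi.single i 1)).det) _ t :=
      hasDerivAt_det (A' := A'.updateRow j 0) fun k l => by
        by_cases hk : k = j
        · subst hk
          simpa using hasDerivAt_const t _
        · simpa [Matrix.updateRow_ne hk] using hA k l
    refine ⟨_, (h1.mul h2).congr_of_eventuallyEq (Eventually.of_forall fun s => ?_)⟩
    simp [Matrix.inv_def, Ring.inverse_eq_inv', Matrix.adjugate_apply]
  choose D hD using hdiff
  -- its derivative is found by differentiating the product of the matrix and its inverse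
  have hprod : ∀ k l, (A' * (A t)⁻¹ + A t * Matrix.of D) k l = 0 := by
    intro k l
    have h1 : HasDerivAt (fun s => (A s * (A s)⁻¹) k l)
        ((A' * (A t)⁻¹ + A t * Matrix.of D) k l) t := by
      simp only [Matrix.mul_apply, Matrix.add_apply, Matrix.of_apply, ← Finset.sum_add_distrib]
      exact HasDerivAt.fun_sum fun m _ => (hA k m).mul (hD m l)
    have h2 : (fun s => (A s * (A s)⁻¹) k l) = fun _ => (1 : Matrix ι ι ℝ) k l := by
      funext s
      rw [Matrix.mul_nonsing_inv _ (isUnit_iff_ne_zero.2 (hu s))]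
    rw [h2] at h1
    exact h1.unique (hasDerivAt_const t _)
  have hmat : A' * (A t)⁻¹ + A t * Matrix.of D = 0 := by
    ext k l
    exact hprod k l
  have hsol : Matrix.of D = -((A t)⁻¹ * A' * (A t)⁻¹) := by
    have h1 : (A t)⁻¹ * (A' * (A t)⁻¹ + A t * Matrix.of D) = 0 := by rw [hmat, mul_zero]
    rw [mul_add, Matrix.nonsing_inv_mul_cancel_left _ _ (isUnit_iff_ne_zero.2 (hu t)),
      ← mul_assoc] at h1
    exact eq_neg_of_add_eq_zero_right h1
  rw [← hsol]
  exact hD i j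

theorem det_add_vecMulVec {A : Matrix ι ι ℝ} (hA : A.det ≠ 0) (u v : ι → ℝ) :
    (A + vecMulVec u v).det = A.det * (1 + v ⬝ᵥ A⁻¹ *ᵥ u) := by
  have : A + vecMulVec u v = A * (1 + vecMulVec (A⁻¹ *ᵥ u) v) := by
    rw [mul_add, mul_one, mul_vecMulVec, mulVec_mulVec,
      Matrix.mul_nonsing_inv _ (isUnit_iff_ne_zero.2 hA), one_mulVec]
  rw [this, det_mul, vecMulVec_eq Unit, det_one_add_replicateCol_mul_replicateRow]

/-! ### The tau function of a Cauchy-like matrix and its bilinear equation -/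

/-- The Cauchy-like matrix with entries `wᵢ wⱼ / (1 - zᵢ zⱼ)`. -/
noncomputable def cauchyMatrix (z w : ι → ℝ) : Matrix ι ι ℝ :=
  Matrix.of fun i j => w i * w j / (1 - z i * z j)

/-- The determinant of `1` plus a Cauchy-like matrix. -/
noncomputable def cauchyTau (z w : ι → ℝ) : ℝ := (1 + cauchyMatrix z w).det

/-- The negative logarithmic derivative of `cauchyTau` along the flow
`wᵢ' = -(zᵢ⁻¹ - zᵢ) wᵢ / 2`. -/
noncomputable def cauchyRho (z w : ι → ℝ) : ℝ := w ⬝ᵥ (1 + cauchyMatrix z w)⁻¹ *ᵥ (w / z)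

omit [Fintype ι] [DecidableEq ι] in
theorem cauchyMatrix_isSymm (z w : ι → ℝ) : (cauchyMatrix z w)ᵀ = cauchyMatrix z w := by
  ext i j
  simp only [cauchyMatrix, Matrix.transpose_apply, Matrix.of_apply]
  ring

theorem inv_one_add_cauchyMatrix_isSymm (z w : ι → ℝ) :
    ((1 + cauchyMatrix z w)⁻¹)ᵀ = (1 + cauchyMatrix z w)⁻¹ := by
  rw [Matrix.transpose_nonsing_inv, Matrix.transpose_add, Matrix.transpose_one, cauchyMatrix_isSymm]

/-- Multiplying the weights by the nodes changes the Cauchy-like matrix by a rank one matrix. -/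
theorem cauchyTau_mul {z w : ι → ℝ} (hz : ∀ i j, 1 - z i * z j ≠ 0) (h : cauchyTau z w ≠ 0) :
    cauchyTau z (z * w) = cauchyTau z w * (1 - w ⬝ᵥ (1 + cauchyMatrix z w)⁻¹ *ᵥ w) := by
  have : 1 + cauchyMatrix z (z * w) = (1 + cauchyMatrix z w) + vecMulVec (-w) w := by
    rw [add_assoc]
    congr 1
    ext i j
    simp only [cauchyMatrix, Matrix.of_apply, Matrix.add_apply, vecMulVec_apply, Pi.mul_apply,
      Pi.neg_apply]
    have := hz i j
    field_simp
    ring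
  rw [cauchyTau, this, det_add_vecMulVec h, cauchyTau, mulVec_neg, dotProduct_neg, sub_eq_add_neg]

theorem cauchyTau_div {z w : ι → ℝ} (hz0 : ∀ i, z i ≠ 0) (hz : ∀ i j, 1 - z i * z j ≠ 0)
    (h : cauchyTau z w ≠ 0) :
    cauchyTau z (w / z) =
      cauchyTau z w * (1 + (w / z) ⬝ᵥ (1 + cauchyMatrix z w)⁻¹ *ᵥ (w / z)) := by
  have : 1 + cauchyMatrix z (w / z) = (1 + cauchyMatrix z w) + vecMulVec (w / z) (w / z) := by
    rw [add_assoc]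
    congr 1
    ext i j
    simp only [cauchyMatrix, Matrix.of_apply, Matrix.add_apply, vecMulVec_apply, Pi.div_apply]
    have := hz i j
    have := hz0 i
    have := hz0 j
    field_simp
    ring
  rw [cauchyTau, this, det_add_vecMulVec h, cauchyTau]

variable {z : ι → ℝ} {w : ℝ → ι → ℝ}

omit [Fintype ι] in
theorem hasDerivAt_one_add_cauchyMatrix (hz0 : ∀ i, z i ≠ 0) (hz : ∀ i j, 1 - z i * z j ≠ 0)
    (hw : ∀ i t, HasDerivAt (fun s => w s i) (-(((z i)⁻¹ - z i) / 2) * w t i) t) (t : ℝ) (i j : ι) :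
    HasDerivAt (fun s => (1 + cauchyMatrix z (w s)) i j)
      ((-(1 / 2 : ℝ) • (vecMulVec (w t) (w t / z) + vecMulVec (w t / z) (w t))) i j) t := by
  have h := (((hw i t).mul (hw j t)).div_const (1 - z i * z j)).const_add ((1 : Matrix ι ι ℝ) i j)
  refine h.congr_deriv ?_
  simp only [Matrix.smul_apply, Matrix.add_apply, vecMulVec_apply, Pi.div_apply, smul_eq_mul]
  have := hz i j
  have := hz0 i
  have := hz0 j
  field_simp
  ring

theorem hasDerivAt_cauchyTau (hz0 : ∀ i, z i ≠ 0) (hz : ∀ i j, 1 - z i * z j ≠ 0)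
    (hw : ∀ i t, HasDerivAt (fun s => w s i) (-(((z i)⁻¹ - z i) / 2) * w t i) t)
    (hτ : ∀ t, cauchyTau z (w t) ≠ 0) (t : ℝ) :
    HasDerivAt (fun s => cauchyTau z (w s)) (-(cauchyTau z (w t) * cauchyRho z (w t))) t := by
  refine (hasDerivAt_det (hasDerivAt_one_add_cauchyMatrix hz0 hz hw t)).congr_deriv ?_
  set A := 1 + cauchyMatrix z (w t) with hA
  have hdet : A.det ≠ 0 := hτ t
  have hadj : A.adjugate = A.det • A⁻¹ := by
    rw [Matrix.inv_def, Ring.inverse_eq_inv', smul_smul, mul_inv_cancel₀ hdet, one_smul]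
  have hsymm : (A⁻¹)ᵀ = A⁻¹ := inv_one_add_cauchyMatrix_isSymm z (w t)
  have hcomm : A⁻¹ *ᵥ w t ⬝ᵥ (w t / z) = w t ⬝ᵥ A⁻¹ *ᵥ (w t / z) := by
    rw [dotProduct_mulVec, ← mulVec_transpose, hsymm]
  rw [hadj, Matrix.smul_mul, Matrix.mul_smul, Matrix.mul_add, mul_vecMulVec, mul_vecMulVec,
    trace_smul, trace_smul, trace_add, trace_vecMulVec, trace_vecMulVec, hcomm,
    dotProduct_comm (A⁻¹ *ᵥ (w t / z)), cauchyRho, ← hA, cauchyTau, ← hA, smul_eq_mul, smul_eq_mul]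
  ring

/-- The bilinear Toda equation: together with `hasDerivAt_cauchyTau` it says that
`(log τ)'' = τ₊ τ₋ / τ² - 1`, where `τ₊` and `τ₋` have weights `z w` and `w / z`. The proof
expresses both sides through `w`, `w / z` and `(1 + C)⁻¹`, and compares them by means of two
commutation relations of `1 + C` with diagonal matrices. -/
theorem hasDerivAt_cauchyRho (hz0 : ∀ i, z i ≠ 0) (hz : ∀ i j, 1 - z i * z j ≠ 0)
    (hw : ∀ i t, HasDerivAt (fun s => w s i) (-(((z i)⁻¹ - z i) / 2) * w t i) t)
    (hτ : ∀ t, cauchyTau z (w t) ≠ 0) (t : ℝ) :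
    HasDerivAt (fun s => cauchyRho z (w s))
      (1 - cauchyTau z (z * w t) * cauchyTau z (w t / z) / cauchyTau z (w t) ^ 2) t := by
  set A := 1 + cauchyMatrix z (w t) with hA
  set u := w t with hu
  set v := u / z with hv
  set S : Matrix ι ι ℝ := diagonal fun i => ((z i)⁻¹ - z i) / 2 with hS
  set C' : Matrix ι ι ℝ := -(1 / 2 : ℝ) • (vecMulVec u v + vecMulVec v u) with hC'
  have hdet : A.det ≠ 0 := hτ t
  have hunit := isUnit_iff_ne_zero.2 hdet
  have hsymm : (A⁻¹)ᵀ = A⁻¹ := inv_one_add_cauchyMatrix_isSymm z u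
  have hAsymm : Aᵀ = A := by
    rw [hA, Matrix.transpose_add, Matrix.transpose_one, cauchyMatrix_isSymm]
  -- the derivative before simplification
  have hder : HasDerivAt (fun s => cauchyRho z (w s)) (-(S *ᵥ u) ⬝ᵥ A⁻¹ *ᵥ v +
      u ⬝ᵥ (-(A⁻¹ * C' * A⁻¹)) *ᵥ v + u ⬝ᵥ A⁻¹ *ᵥ (-(S *ᵥ v))) t := by
    have hwv : ∀ j, HasDerivAt (fun s => (w s / z) j) ((-(S *ᵥ v)) j) t := fun j => by
      refine ((hw j t).div_const (z j)).congr_deriv ?_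
      simp only [hS, Pi.neg_apply, mulVec_diagonal, hv, Pi.div_apply, hu]
      ring
    have hwu : ∀ j, HasDerivAt (fun s => w s j) ((-(S *ᵥ u)) j) t := fun j => by
      refine (hw j t).congr_deriv ?_
      simp only [hS, Pi.neg_apply, mulVec_diagonal, hu]
      ring
    have hinv := hasDerivAt_matrix_inv (hasDerivAt_one_add_cauchyMatrix hz0 hz hw t) hτ
    have := HasDerivAt.fun_sum (u := Finset.univ) fun i _ => (hwu i).mul
      (HasDerivAt.fun_sum (u := Finset.univ) fun j _ => (hinv i j).mul (hwv j))
    refine this.congr_deriv ?_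
    simp only [dotProduct, mulVec, Finset.sum_add_distrib, mul_add, add_assoc]
    rfl
  refine hder.congr_deriv ?_
  set p := A⁻¹ *ᵥ u with hp
  set r := A⁻¹ *ᵥ v with hr
  have hAp : A *ᵥ p = u := by rw [hp, mulVec_mulVec, Matrix.mul_nonsing_inv _ hunit, one_mulVec]
  have hAr : A *ᵥ r = v := by rw [hr, mulVec_mulVec, Matrix.mul_nonsing_inv _ hunit, one_mulVec]
  have hpa : ∀ x, p ⬝ᵥ A *ᵥ x = u ⬝ᵥ x := fun x => by
    rw [dotProduct_mulVec, ← mulVec_transpose, hAsymm, hAp]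
  have hup : ∀ x, u ⬝ᵥ A⁻¹ *ᵥ x = p ⬝ᵥ x := fun x => by
    rw [dotProduct_mulVec, ← mulVec_transpose, hsymm]
  have hSs : ∀ x y, (S *ᵥ x) ⬝ᵥ y = x ⬝ᵥ S *ᵥ y := fun x y => by
    rw [dotProduct_mulVec, ← mulVec_transpose, diagonal_transpose]
  -- the two commutation relations
  have hcomm₁ : A * S + S * A = (2 : ℝ) • S + (1 / 2 : ℝ) • (vecMulVec u v + vecMulVec v u) := by
    ext i j
    simp only [hA, hS, Matrix.add_mul, Matrix.mul_add, one_mul, mul_one, Matrix.add_apply,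
      Matrix.mul_diagonal, Matrix.diagonal_mul, Matrix.smul_apply, vecMulVec_apply, cauchyMatrix,
      Matrix.of_apply, smul_eq_mul, hv, Pi.div_apply]
    have := hz i j
    have := hz0 i
    have := hz0 j
    field_simp
    ring_nf
  have hcomm₂ : (2 : ℝ) • S =
      A * diagonal (fun i => (z i)⁻¹) - diagonal z * A - vecMulVec u v := by
    ext i j
    simp only [hA, hS, Matrix.add_mul, Matrix.mul_add, one_mul, mul_one, Matrix.add_apply,
      Matrix.sub_apply,
      Matrix.mul_diagonal, Matrix.diagonal_mul, Matrix.smul_apply, vecMulVec_apply, cauchyMatrix,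
      Matrix.of_apply, smul_eq_mul, hv, Pi.div_apply]
    have := hz i j
    have := hz0 i
    have := hz0 j
    by_cases hij : i = j
    · subst hij
      simp only [diagonal_apply_eq]
      have : 1 - z i ^ 2 ≠ 0 := by rw [sq]; exact hz i i
      field_simp
      ring
    · simp only [diagonal_apply_ne _ hij]
      field_simp
      ring
  have e₁ : u ⬝ᵥ S *ᵥ r + p ⬝ᵥ S *ᵥ v =
      p ⬝ᵥ ((2 : ℝ) • S) *ᵥ r + (1 / 2) * ((p ⬝ᵥ u) * (v ⬝ᵥ r) + (p ⬝ᵥ v) * (u ⬝ᵥ r)) := by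
    have h1 : A *ᵥ S *ᵥ r + S *ᵥ v = (A * S + S * A) *ᵥ r := by
      rw [add_mulVec (A * S), ← mulVec_mulVec, ← mulVec_mulVec, hAr]
    rw [← hpa (S *ᵥ r), ← dotProduct_add, h1, hcomm₁, add_mulVec, dotProduct_add,
      smul_mulVec (1 / 2 : ℝ), add_mulVec, vecMulVec_mulVec, vecMulVec_mulVec]
    simp [dotProduct_smul]
    ring
  have e₂ : p ⬝ᵥ ((2 : ℝ) • S) *ᵥ r = v ⬝ᵥ r - p ⬝ᵥ u - (p ⬝ᵥ u) * (v ⬝ᵥ r) := by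
    have h1 : u ⬝ᵥ diagonal (fun i => (z i)⁻¹) *ᵥ r = v ⬝ᵥ r := by
      simp only [dotProduct, mulVec_diagonal, hv, Pi.div_apply]
      exact Finset.sum_congr rfl fun i _ => by ring
    have h2 : diagonal z *ᵥ v = u := by
      funext i
      rw [mulVec_diagonal, hv, Pi.div_apply, mul_div_cancel₀ _ (hz0 i)]
    rw [hcomm₂, sub_mulVec, sub_mulVec, dotProduct_sub, dotProduct_sub, ← mulVec_mulVec, hpa, h1,
      ← mulVec_mulVec, hAr, h2, vecMulVec_mulVec]
    simp [dotProduct_smul]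
    ring
  have e₃ : u ⬝ᵥ (-(A⁻¹ * C' * A⁻¹)) *ᵥ v =
      (1 / 2) * ((p ⬝ᵥ u) * (v ⬝ᵥ r) + (p ⬝ᵥ v) * (u ⬝ᵥ r)) := by
    rw [neg_mulVec, ← mulVec_mulVec, ← mulVec_mulVec, ← hr, dotProduct_neg, hup, hC', smul_mulVec,
      add_mulVec, vecMulVec_mulVec, vecMulVec_mulVec]
    simp [dotProduct_smul]
    ring
  rw [cauchyTau_mul hz (hτ t), cauchyTau_div hz0 hz (hτ t), ← hA, ← hv, ← hp, ← hr, e₃, mulVec_neg,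
    dotProduct_neg, hup (S *ᵥ v), neg_dotProduct, hSs, dotProduct_comm u p]
  have hne : cauchyTau z u ≠ 0 := hτ t
  have hfrac : cauchyTau z u * (1 - p ⬝ᵥ u) * (cauchyTau z u * (1 + v ⬝ᵥ r)) / cauchyTau z u ^ 2 =
      (1 - p ⬝ᵥ u) * (1 + v ⬝ᵥ r) := by field_simp
  rw [hfrac]
  linear_combination -e₁ - e₂

end MatrixCalculus

/-! ### Expansion of the tau function in exponentials -/

section Expansion

variable {ι : Type*} [Fintype ι] [DecidableEq ι]

/-- The determinant of `1 + M` is the sum of the principal minors of `M`. -/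
theorem det_one_add_eq_sum_minors (M : Matrix ι ι ℝ) :
    (1 + M).det =
      ∑ s : Finset ι, (M.submatrix (Subtype.val : s → ι) (Subtype.val : s → ι)).det := by
  have hdeg : (Matrix.det (1 + (Polynomial.X : Polynomial ℝ) • M.map Polynomial.C)).natDegree <
      (Finset.univ : Finset ι).card + 1 := by
    have := Polynomial.natDegree_det_X_add_C_le M (1 : Matrix ι ι ℝ)
    rw [Matrix.map_one _ Polynomial.C_0 Polynomial.C_1, add_comm] at this
    rw [Finset.card_univ]
    omega
  have h1 : (1 + M).det =
      (Matrix.det (1 + (Polynomial.X : Polynomial ℝ) • M.map Polynomial.C)).eval 1 := by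
    rw [← Polynomial.coe_evalRingHom, RingHom.map_det]
    congr 1
    ext i j
    by_cases hij : i = j <;> simp [hij]
  rw [h1, Polynomial.eval_eq_sum_range' hdeg, ← Finset.powerset_univ, Finset.sum_powerset]
  refine Finset.sum_congr rfl fun k _ => ?_
  rw [one_pow, mul_one, Matrix.coeff_det_one_add_X_smul_eq_sum_minors]

omit [DecidableEq ι] in
/-- Cauchy-like matrices with nodes in `(-1, 1)` are Gram matrices: expand `1 / (1 - zᵢ zⱼ)` in a
geometric series. -/
theorem cauchyMatrix_posSemidef {z : ι → ℝ} (hz : ∀ i, |z i| < 1) (w : ι → ℝ) :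
    (cauchyMatrix z w).PosSemidef := by
  refine PosSemidef.of_dotProduct_mulVec_nonneg ?_ fun x => ?_
  · rw [Matrix.IsHermitian, conjTranspose_eq_transpose_of_trivial, cauchyMatrix_isSymm]
  · have h : HasSum (fun k : ℕ => (∑ i, x i * w i * z i ^ k) ^ 2)
        (∑ i, ∑ j, x i * (w i * w j / (1 - z i * z j)) * x j) := by
      have : ∀ k : ℕ, (∑ i, x i * w i * z i ^ k) ^ 2 =
          ∑ i, ∑ j, (x i * w i * w j * x j) * (z i * z j) ^ k := fun k => by
        rw [sq, Finset.sum_mul_sum]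
        refine Finset.sum_congr rfl fun i _ => Finset.sum_congr rfl fun j _ => ?_
        ring
      simp_rw [this]
      refine hasSum_sum fun i _ => hasSum_sum fun j _ => ?_
      have hlt : |z i * z j| < 1 := by
        rw [abs_mul]
        exact mul_lt_one_of_nonneg_of_lt_one_left (abs_nonneg _) (hz i) (hz j).le
      have := (hasSum_geometric_of_abs_lt_one hlt).mul_left (x i * w i * w j * x j)
      have e : x i * (w i * w j / (1 - z i * z j)) * x j =
          x i * w i * w j * x j * (1 - z i * z j)⁻¹ := by
        rw [div_eq_mul_inv]
        ring
      rwa [e]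
    have h2 := h.nonneg fun k => sq_nonneg _
    convert h2 using 1
    simp only [dotProduct, mulVec, cauchyMatrix, Matrix.of_apply, Finset.mul_sum, star_trivial]
    exact Finset.sum_congr rfl fun i _ => Finset.sum_congr rfl fun j _ => by ring

/-- The coefficients of `cauchyTau` as a polynomial in the squares of the weights. -/
noncomputable def cauchyCoeff (z : ι → ℝ) (s : Finset ι) : ℝ :=
  (cauchyMatrix (fun i : s => z i) 1).det

omit [Fintype ι] in
theorem cauchyCoeff_nonneg {z : ι → ℝ} (hz : ∀ i, |z i| < 1) (s : Finset ι) : 0 ≤ cauchyCoeff z s :=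
  (cauchyMatrix_posSemidef (z := fun i : s => z i) (fun i => hz i) 1).det_nonneg

omit [Fintype ι] in
theorem cauchyCoeff_empty (z : ι → ℝ) : cauchyCoeff z ∅ = 1 := det_isEmpty

theorem cauchyTau_eq_sum (z w : ι → ℝ) :
    cauchyTau z w = ∑ s : Finset ι, cauchyCoeff z s * ∏ i ∈ s, w i ^ 2 := by
  rw [cauchyTau, det_one_add_eq_sum_minors]
  refine Finset.sum_congr rfl fun s _ => ?_
  have : (cauchyMatrix z w).submatrix (Subtype.val : s → ι) (Subtype.val : s → ι) =
      diagonal (fun i : s => w i) * cauchyMatrix (fun i : s => z i) 1 *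
        diagonal (fun i : s => w i) := by
    ext i j
    simp only [cauchyMatrix, Matrix.mul_diagonal, Matrix.diagonal_mul, Matrix.submatrix_apply,
      Matrix.of_apply, Pi.one_apply]
    ring
  rw [this, det_mul, det_mul, det_diagonal, cauchyCoeff, ← Finset.prod_coe_sort s fun i => w i ^ 2,
    Finset.prod_pow]
  ring

theorem cauchyTau_congr_sq {z w w' : ι → ℝ} (h : ∀ i, w i ^ 2 = w' i ^ 2) :
    cauchyTau z w = cauchyTau z w' := by
  simp_rw [cauchyTau_eq_sum, h]

end Expansion

/-! ### Sums of exponentials with nonnegative coefficients -/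

section ExpSum

variable {ι : Type*} [Fintype ι]

/-- A sum of exponentials with nonnegative coefficients, at least one of them positive, has a
leading
exponent at `+∞`, which does not change when the terms are modulated by further factors. -/
theorem exists_leading_exponent {c : ι → ℝ} (hc : ∀ i, 0 ≤ c i) (hpos : ∃ i, 0 < c i) (a : ι → ℝ) :
    ∃ A : ℝ, (∃ i, a i = A ∧ 0 < c i) ∧ ∀ e : ι → ℝ, ∃ D : ℝ, D = ∑ i with a i = A, c i * e i ∧
      Tendsto (fun x : ℝ => (∑ i, c i * e i * Real.exp (a i * x)) * Real.exp (-(A * x)))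
        atTop (𝓝 D) := by
  obtain ⟨i₀, hi₀⟩ := hpos
  obtain ⟨m, hm, hmax⟩ := Finset.exists_max_image (Finset.univ.filter fun i => 0 < c i) a
    ⟨i₀, by simpa using hi₀⟩
  refine ⟨a m, ⟨m, rfl, by simpa using hm⟩, fun e => ⟨_, rfl, ?_⟩⟩
  rw [Finset.sum_filter]
  simp_rw [Finset.sum_mul]
  refine tendsto_finsetSum _ fun i _ => ?_
  have hrw : ∀ x, c i * e i * Real.exp (a i * x) * Real.exp (-(a m * x)) =
      c i * e i * Real.exp ((a i - a m) * x) := fun x => by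
    rw [mul_assoc, ← Real.exp_add]
    ring_nf
  simp_rw [hrw]
  split_ifs with hi
  · simp [hi]
  · rcases (hc i).eq_or_lt with h0 | h0
    · simp [← h0]
    · have hlt : a i - a m < 0 := sub_neg.2 (lt_of_le_of_ne (hmax i (by simpa using h0)) hi)
      have h := Real.tendsto_exp_atBot.comp (tendsto_id.const_mul_atTop_of_neg hlt)
      simpa using h.const_mul (c i * e i)

/-- A sum of exponentials with nonnegative coefficients in two variables. -/
noncomputable def expSum (c a b : ι → ℝ) (x t : ℝ) : ℝ := ∑ i, c i * Real.exp (a i * x + b i * t)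

variable {c : ι → ℝ} (hc : ∀ i, 0 ≤ c i) (a b : ι → ℝ)
include hc

theorem expSum_pos (hpos : ∃ i, 0 < c i) (x t : ℝ) : 0 < expSum c a b x t := by
  obtain ⟨i, hi⟩ := hpos
  exact Finset.sum_pos' (fun j _ => mul_nonneg (hc j) (Real.exp_pos _).le)
    ⟨i, Finset.mem_univ i, mul_pos hi (Real.exp_pos _)⟩

omit hc in
theorem hasDerivAt_expSum (c a b : ι → ℝ) (x t : ℝ) :
    HasDerivAt (fun s => expSum c a b x s) (∑ i, c i * b i * Real.exp (a i * x + b i * t)) t := by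
  refine HasDerivAt.fun_sum fun i _ => ?_
  have h := (((hasDerivAt_id t).const_mul (b i)).const_add (a i * x)).exp.const_mul (c i)
  exact h.congr_deriv (by simp; ring)

theorem abs_deriv_expSum_le {B : ℝ} (hB : ∀ i, |b i| ≤ B) (x t : ℝ) :
    |∑ i, c i * b i * Real.exp (a i * x + b i * t)| ≤ B * expSum c a b x t := by
  rw [expSum, Finset.mul_sum]
  refine (Finset.abs_sum_le_sum_abs _ _).trans (Finset.sum_le_sum fun i _ => ?_)
  rw [abs_mul, abs_mul, abs_of_nonneg (hc i), Real.abs_exp]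
  have := mul_nonneg (hc i) (Real.exp_pos (a i * x + b i * t)).le
  nlinarith [hB i]

theorem expSum_le {B : ℝ} (hB : ∀ i, |a i| ≤ B) {x y : ℝ} (hxy : |x - y| ≤ 1) (t : ℝ) :
    expSum c a b x t ≤ Real.exp B * expSum c a b y t := by
  rw [expSum, expSum, Finset.mul_sum]
  refine Finset.sum_le_sum fun i _ => ?_
  rw [mul_left_comm, ← Real.exp_add]
  refine mul_le_mul_of_nonneg_left (Real.exp_le_exp.2 ?_) (hc i)
  have h1 : a i * (x - y) ≤ |a i| * |x - y| := by
    rw [← abs_mul]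
    exact le_abs_self _
  have h2 : |a i| * |x - y| ≤ B * 1 :=
    mul_le_mul (hB i) hxy (abs_nonneg _) ((abs_nonneg _).trans (hB i))
  nlinarith

/-- Neighbouring values have bounded logarithmic ratio. -/
theorem abs_log_expSum_div_le (hpos : ∃ i, 0 < c i) {B : ℝ} (hB : ∀ i, |a i| ≤ B) (x t : ℝ) :
    |Real.log (expSum c a b x t / expSum c a b (x - 1) t)| ≤ B := by
  have h1 := expSum_pos hc a b hpos x t
  have h2 := expSum_pos hc a b hpos (x - 1) t
  have h3 := expSum_le hc a b hB (x := x) (y := x - 1) (by simp) t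
  have h4 := expSum_le hc a b hB (x := x - 1) (y := x) (by simp) t
  rw [abs_le]
  constructor
  · rw [Real.le_log_iff_exp_le (div_pos h1 h2), le_div_iff₀ h2, Real.exp_neg,
      inv_mul_le_iff₀ (Real.exp_pos B)]
    exact h4
  · rw [Real.log_le_iff_le_exp (div_pos h1 h2), div_le_iff₀ h2]
    exact h3

/-- At `+∞` the ratio of neighbouring values converges to a limit independent of the time, and the
logarithmic time derivative converges. -/
theorem expSum_asymptotics (hpos : ∃ i, 0 < c i) : ∃ A : ℝ, ∀ t : ℝ,
    (∀ h : ℝ, Tendsto (fun x => expSum c a b (x + h) t / expSum c a b x t) atTop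
      (𝓝 (Real.exp (A * h)))) ∧
    ∃ D : ℝ, Tendsto (fun x => (∑ i, c i * b i * Real.exp (a i * x + b i * t)) / expSum c a b x t)
      atTop (𝓝 D) := by
  obtain ⟨A, ⟨m, hmA, hm⟩, hA⟩ := exists_leading_exponent hc hpos a
  refine ⟨A, fun t => ?_⟩
  obtain ⟨D₀, hD₀, h₀⟩ := hA fun i => Real.exp (b i * t)
  obtain ⟨D₁, -, h₁⟩ := hA fun i => b i * Real.exp (b i * t)
  have e₀ : ∀ x, (∑ i, c i * Real.exp (b i * t) * Real.exp (a i * x)) = expSum c a b x t := fun x =>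
    Finset.sum_congr rfl fun i _ => by
      rw [mul_assoc, ← Real.exp_add, add_comm]
  have e₁ : ∀ x, (∑ i, c i * (b i * Real.exp (b i * t)) * Real.exp (a i * x)) =
      ∑ i, c i * b i * Real.exp (a i * x + b i * t) := fun x =>
    Finset.sum_congr rfl fun i _ => by
      rw [← mul_assoc, mul_assoc (c i * b i), ← Real.exp_add, add_comm (a i * x)]
  simp_rw [e₀] at h₀
  simp_rw [e₁] at h₁
  have hD₀pos : 0 < D₀ := by
    rw [hD₀]
    exact Finset.sum_pos' (fun j _ => mul_nonneg (hc j) (Real.exp_pos _).le)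
      ⟨m, by simpa using hmA, mul_pos hm (Real.exp_pos _)⟩
  refine ⟨fun h => ?_, D₁ / D₀, ?_⟩
  · have h2 := (h₀.comp (tendsto_atTop_add_const_right atTop h tendsto_id)).div h₀ hD₀pos.ne'
    rw [div_self hD₀pos.ne'] at h2
    have h3 := h2.mul_const (Real.exp (A * h))
    rw [one_mul] at h3
    refine h3.congr fun x => ?_
    have e1 : Real.exp (-(A * (x + h))) * Real.exp (A * h) = Real.exp (-(A * x)) := by
      rw [← Real.exp_add]
      ring_nf
    have hne := (expSum_pos hc a b hpos x t).ne'
    have hne' := (Real.exp_pos (-(A * x))).ne'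
    simp only [Pi.div_apply, Function.comp_apply, id]
    rw [div_mul_eq_mul_div, mul_assoc, e1, mul_div_mul_right _ _ hne']
  · refine (h₁.div h₀ hD₀pos.ne').congr fun x => ?_
    exact mul_div_mul_right _ _ (Real.exp_pos (-(A * x))).ne'

end ExpSum

/-! ### Differentiability in the sup norm -/

/-- A curve in `ℓ^∞` with componentwise derivatives is differentiable in the sup norm if these
derivatives form a continuous curve in `ℓ^∞`. -/
theorem hasDerivAt_of_forall_apply {V : Type*} {f g : ℝ → EllInf V} (hg : Continuous g)
    (h : ∀ x t, HasDerivAt (fun s => f s x) (g t x) t) (t : ℝ) : HasDerivAt f (g t) t := by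
  have hf : f = fun t => f 0 + ∫ s in (0 : ℝ)..t, g s := by
    funext t
    ext x
    have h1 : (∫ s in (0 : ℝ)..t, g s) x = ∫ s in (0 : ℝ)..t, g s x :=
      ((lp.evalCLM ℝ (fun _ : V => ℝ) ∞ x).intervalIntegral_comp_comm
        (hg.intervalIntegrable 0 t)).symm
    have hgx : Continuous fun s => g s x :=
      (lp.evalCLM ℝ (fun _ : V => ℝ) ∞ x).continuous.comp hg
    have h2 := intervalIntegral.integral_eq_sub_of_hasDerivAt (fun s _ => h x s)
      (hgx.intervalIntegrable 0 t)
    rw [lp.coeFn_add, Pi.add_apply, h1, h2]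
    ring
  rw [hf]
  exact ((hg.integral_hasStrictDerivAt 0 t).hasDerivAt).const_add (f 0)

/-- A curve in `ℓ^∞` with uniformly bounded componentwise derivatives is continuous. -/
theorem continuous_of_forall_apply {V : Type*} {f : ℝ → EllInf V} {g : V → ℝ → ℝ} {B : ℝ}
    (hB : ∀ x t, |g x t| ≤ B) (hB0 : 0 ≤ B) (h : ∀ x t, HasDerivAt (fun s => f s x) (g x t) t) :
    Continuous f := by
  refine ((LipschitzWith.coordinate (f := f) B.toNNReal).2 fun x => ?_).continuous
  refine lipschitzWith_of_nnnorm_deriv_le (fun t => (h x t).differentiableAt) fun t => ?_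
  rw [(h x t).deriv, ← NNReal.coe_le_coe, coe_nnnorm, Real.norm_eq_abs, Real.coe_toNNReal B hB0]
  exact hB x t

theorem continuous_chainForce : Continuous chainForce := by
  let _ : NormedAlgebra ℚ (EllInf ℤ) := NormedAlgebra.restrictScalars ℚ ℝ (EllInf ℤ)
  exact (NormedSpace.exp_continuous.comp ((shiftInf (-1)).continuous.sub continuous_id)).sub
    (NormedSpace.exp_continuous.comp (continuous_id.sub (shiftInf 1).continuous))

/-- A curve in phase space that solves the equations of the chain componentwise is a solution,
provided velocities and accelerations are bounded uniformly in space and time. -/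
theorem chain_isSolutionOn_of_forall_apply {c : ℝ → Phase ℤ} {B : ℝ}
    (hB : ∀ n t, |(c t).2 n| ≤ B) (hB0 : 0 ≤ B)
    (hB' : ∀ t n, |chain.accel todaU (c t).1 n| ≤ B)
    (h1 : ∀ n t, HasDerivAt (fun s => (c s).1 n) ((c t).2 n) t)
    (h2 : ∀ n t, HasDerivAt (fun s => (c s).2 n) (chain.accel todaU (c t).1 n) t) :
    chain.IsSolutionOn todaU c univ := by
  have hc1 : Continuous fun t => (c t).1 := continuous_of_forall_apply hB hB0 h1
  have hc2 : Continuous fun t => (c t).2 :=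
    continuous_of_forall_apply (fun n t => hB' t n) hB0 h2
  refine chain_isSolutionOn_iff.2 fun t _ => HasDerivAt.hasDerivWithinAt ?_
  exact (hasDerivAt_of_forall_apply hc2 h1 t).prodMk
    (hasDerivAt_of_forall_apply (continuous_chainForce.comp hc1)
      (fun n t => (h2 n t).congr_deriv (chainForce_apply _ n).symm) t)

/-! ### Solitons -/

section Soliton

variable {N : ℕ} (κ γ σ : Fin N → ℝ)

/-- The nodes `zᵢ = σᵢ exp (-κᵢ)` of the soliton matrix. -/
noncomputable def solitonNode (i : Fin N) : ℝ := σ i * Real.exp (-κ i)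

/-- The weights of the soliton matrix. -/
noncomputable def solitonWeight (n : ℤ) (t : ℝ) (i : Fin N) : ℝ :=
  Real.sqrt (γ i) * Real.exp (-κ i * n - σ i * Real.sinh (κ i) * t)

/-- The negative logarithmic time derivative of the tau function. -/
noncomputable def solitonRho (n : ℤ) (t : ℝ) : ℝ :=
  cauchyRho (solitonNode κ σ) (solitonWeight κ γ σ n t)

/-- The coefficients of the tau function as a sum of exponentials. -/
noncomputable def solitonCoeff (s : Finset (Fin N)) : ℝ :=
  cauchyCoeff (solitonNode κ σ) s * ∏ i ∈ s, γ i

/-- The spatial exponents of the tau function. -/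
noncomputable def solitonExpX (s : Finset (Fin N)) : ℝ := ∑ i ∈ s, -2 * κ i

/-- The temporal exponents of the tau function. -/
noncomputable def solitonExpT (s : Finset (Fin N)) : ℝ := ∑ i ∈ s, -2 * (σ i * Real.sinh (κ i))

variable {κ γ σ}

theorem solitonTau_eq_cauchyTau (hγ : ∀ j, 0 < γ j) (n : ℤ) (t : ℝ) :
    solitonTau κ γ σ n t = cauchyTau (solitonNode κ σ) (solitonWeight κ γ σ n t) := by
  rw [solitonTau, cauchyTau]
  congr 2
  ext i j
  simp only [solitonMatrix, cauchyMatrix, solitonNode, solitonWeight, Matrix.of_apply]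
  rw [Real.sqrt_mul (hγ i).le, mul_mul_mul_comm (σ i), ← Real.exp_add, mul_mul_mul_comm √(γ i),
    ← Real.exp_add, div_mul_eq_mul_div]
  congr 3 <;> ring_nf

theorem sq_solitonWeight (hγ : ∀ j, 0 < γ j) (n : ℤ) (t : ℝ) (i : Fin N) :
    solitonWeight κ γ σ n t i ^ 2 =
      γ i * Real.exp (-2 * κ i * n + -2 * (σ i * Real.sinh (κ i)) * t) := by
  rw [solitonWeight, mul_pow, Real.sq_sqrt (hγ i).le, ← Real.exp_nat_mul]
  congr 2
  push_cast
  ring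

theorem solitonTau_eq_expSum (hγ : ∀ j, 0 < γ j) (n : ℤ) (t : ℝ) :
    solitonTau κ γ σ n t =
      expSum (solitonCoeff κ γ σ) (solitonExpX κ) (solitonExpT κ σ) n t := by
  rw [solitonTau_eq_cauchyTau hγ, cauchyTau_eq_sum]
  refine Finset.sum_congr rfl fun s _ => ?_
  rw [solitonCoeff, solitonExpX, solitonExpT, Finset.sum_mul, Finset.sum_mul,
    ← Finset.sum_add_distrib, Real.exp_sum, mul_assoc, ← Finset.prod_mul_distrib]
  congr 1
  exact Finset.prod_congr rfl fun i _ => sq_solitonWeight hγ n t i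

variable (hκ : ∀ j, 0 < κ j) (hγ : ∀ j, 0 < γ j) (hσ : ∀ j, σ j = 1 ∨ σ j = -1)
include hκ hσ

theorem abs_solitonNode_lt_one (i : Fin N) : |solitonNode κ σ i| < 1 := by
  have : |σ i| = 1 := by rcases hσ i with h | h <;> simp [h]
  rw [solitonNode, abs_mul, this, one_mul, Real.abs_exp, Real.exp_lt_one_iff]
  linarith [hκ i]

theorem one_sub_solitonNode_mul_ne (i j : Fin N) :
    1 - solitonNode κ σ i * solitonNode κ σ j ≠ 0 := by
  have h : |solitonNode κ σ i * solitonNode κ σ j| < 1 := by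
    rw [abs_mul]
    exact mul_lt_one_of_nonneg_of_lt_one_left (abs_nonneg _) (abs_solitonNode_lt_one hκ hσ i)
      (abs_solitonNode_lt_one hκ hσ j).le
  exact (sub_pos.2 (abs_lt.1 h).2).ne'

omit hκ in
theorem solitonNode_ne_zero (i : Fin N) : solitonNode κ σ i ≠ 0 := by
  have : σ i ≠ 0 := by rcases hσ i with h | h <;> simp [h]
  exact mul_ne_zero this (Real.exp_pos _).ne'

omit hκ in
theorem solitonNode_flow (i : Fin N) :
    ((solitonNode κ σ i)⁻¹ - solitonNode κ σ i) / 2 = σ i * Real.sinh (κ i) := by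
  have : (σ i)⁻¹ = σ i := by rcases hσ i with h | h <;> simp [h]
  rw [solitonNode, mul_inv, this, Real.exp_neg, inv_inv, Real.sinh_eq, Real.exp_neg]
  ring

omit hκ in
theorem hasDerivAt_solitonWeight (n : ℤ) (i : Fin N) (t : ℝ) :
    HasDerivAt (fun s => solitonWeight κ γ σ n s i)
      (-(((solitonNode κ σ i)⁻¹ - solitonNode κ σ i) / 2) * solitonWeight κ γ σ n t i) t := by
  rw [solitonNode_flow hσ]
  have h := (((hasDerivAt_id t).const_mul (σ i * Real.sinh (κ i))).const_sub (-κ i * n)).exp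
    |>.const_mul
    √(γ i)
  exact h.congr_deriv (by simp [solitonWeight]; ring)

include hγ

theorem solitonCoeff_nonneg (s : Finset (Fin N)) : 0 ≤ solitonCoeff κ γ σ s :=
  mul_nonneg (cauchyCoeff_nonneg (abs_solitonNode_lt_one hκ hσ) s)
    (Finset.prod_nonneg fun i _ => (hγ i).le)

omit hκ hγ hσ in
theorem exists_solitonCoeff_pos : ∃ s, 0 < solitonCoeff κ γ σ s :=
  ⟨∅, by simp [solitonCoeff, cauchyCoeff_empty]⟩

theorem solitonTau_pos (n : ℤ) (t : ℝ) : 0 < solitonTau κ γ σ n t := by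
  rw [solitonTau_eq_expSum hγ]
  exact expSum_pos (solitonCoeff_nonneg hκ hγ hσ) _ _ exists_solitonCoeff_pos _ _

theorem cauchyTau_soliton_ne (n : ℤ) (t : ℝ) :
    cauchyTau (solitonNode κ σ) (solitonWeight κ γ σ n t) ≠ 0 := by
  rw [← solitonTau_eq_cauchyTau hγ]
  exact (solitonTau_pos hκ hγ hσ n t).ne'

theorem hasDerivAt_solitonTau (n : ℤ) (t : ℝ) : HasDerivAt (fun s => solitonTau κ γ σ n s)
    (-(solitonTau κ γ σ n t * solitonRho κ γ σ n t)) t := by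
  simp_rw [solitonTau_eq_cauchyTau hγ]
  exact hasDerivAt_cauchyTau (solitonNode_ne_zero hσ) (one_sub_solitonNode_mul_ne hκ hσ)
    (hasDerivAt_solitonWeight hσ n) (cauchyTau_soliton_ne hκ hγ hσ n) t

omit hκ in
theorem solitonTau_succ (n : ℤ) (t : ℝ) : solitonTau κ γ σ (n + 1) t =
    cauchyTau (solitonNode κ σ) (solitonNode κ σ * solitonWeight κ γ σ n t) := by
  rw [solitonTau_eq_cauchyTau hγ]
  refine cauchyTau_congr_sq fun i => ?_
  have : σ i ^ 2 = 1 := by rcases hσ i with h | h <;> simp [h]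
  rw [Pi.mul_apply, mul_pow, sq_solitonWeight hγ, sq_solitonWeight hγ, solitonNode, mul_pow, this,
    one_mul, mul_left_comm (Real.exp (-κ i) ^ 2), ← Real.exp_nat_mul, ← Real.exp_add]
  congr 2
  push_cast
  ring

omit hκ in
theorem solitonTau_pred (n : ℤ) (t : ℝ) : solitonTau κ γ σ (n - 1) t =
    cauchyTau (solitonNode κ σ) (solitonWeight κ γ σ n t / solitonNode κ σ) := by
  rw [solitonTau_eq_cauchyTau hγ]
  refine cauchyTau_congr_sq fun i => ?_
  have : σ i ^ 2 = 1 := by rcases hσ i with h | h <;> simp [h]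
  rw [Pi.div_apply, div_pow, sq_solitonWeight hγ, sq_solitonWeight hγ, solitonNode, mul_pow, this,
    one_mul, mul_div_assoc, ← Real.exp_nat_mul, ← Real.exp_sub]
  congr 2
  push_cast
  ring

theorem hasDerivAt_solitonRho (n : ℤ) (t : ℝ) : HasDerivAt (fun s => solitonRho κ γ σ n s)
    (1 - solitonTau κ γ σ (n + 1) t * solitonTau κ γ σ (n - 1) t / solitonTau κ γ σ n t ^ 2) t := by
  rw [solitonTau_succ hγ hσ, solitonTau_pred hγ hσ, solitonTau_eq_cauchyTau hγ]
  exact hasDerivAt_cauchyRho (solitonNode_ne_zero hσ) (one_sub_solitonNode_mul_ne hκ hσ)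
    (hasDerivAt_solitonWeight hσ n) (cauchyTau_soliton_ne hκ hγ hσ n) t

theorem solitonRho_eq (n : ℤ) (t : ℝ) : solitonRho κ γ σ n t =
    -((∑ s, solitonCoeff κ γ σ s * solitonExpT κ σ s *
      Real.exp (solitonExpX κ s * n + solitonExpT κ σ s * t)) /
      expSum (solitonCoeff κ γ σ) (solitonExpX κ) (solitonExpT κ σ) n t) := by
  have h1 := hasDerivAt_solitonTau hκ hγ hσ n t
  have h2 := hasDerivAt_expSum (solitonCoeff κ γ σ) (solitonExpX κ) (solitonExpT κ σ) n t
  have hpos := solitonTau_pos hκ hγ hσ n t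
  simp_rw [solitonTau_eq_expSum hγ] at h1 hpos
  rw [← h1.unique h2, neg_div, neg_neg, mul_div_cancel_left₀ _ hpos.ne']

theorem exists_abs_solitonRho_le : ∃ B : ℝ, ∀ n t, |solitonRho κ γ σ n t| ≤ B := by
  obtain ⟨B, hB⟩ := Finite.exists_le fun s => |solitonExpT κ σ s|
  refine ⟨B, fun n t => ?_⟩
  have hpos := expSum_pos (solitonCoeff_nonneg hκ hγ hσ) (solitonExpX κ) (solitonExpT κ σ)
    exists_solitonCoeff_pos n t
  rw [solitonRho_eq hκ hγ hσ, abs_neg, abs_div, abs_of_pos hpos, div_le_iff₀ hpos]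
  exact abs_deriv_expSum_le (solitonCoeff_nonneg hκ hγ hσ) _ _ hB _ _

theorem exists_abs_solitonQ_le (q₀ : ℝ) : ∃ B : ℝ, ∀ n t, |solitonQ q₀ κ γ σ n t| ≤ B := by
  obtain ⟨B, hB⟩ := Finite.exists_le fun s => |solitonExpX κ s|
  refine ⟨|q₀| + B, fun n t => ?_⟩
  have h := abs_log_expSum_div_le (solitonCoeff_nonneg hκ hγ hσ) (solitonExpX κ) (solitonExpT κ σ)
    exists_solitonCoeff_pos hB n t
  rw [solitonQ, solitonTau_eq_expSum hγ, solitonTau_eq_expSum hγ]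
  push_cast
  exact (abs_sub _ _).trans (by gcongr)

theorem hasDerivAt_solitonQ (q₀ : ℝ) (n : ℤ) (t : ℝ) :
    HasDerivAt (fun s => solitonQ q₀ κ γ σ n s)
      (solitonRho κ γ σ n t - solitonRho κ γ σ (n - 1) t) t := by
  have hp := fun n s => solitonTau_pos hκ hγ hσ n s
  have h1 := (hasDerivAt_solitonTau hκ hγ hσ n t).log (hp n t).ne'
  have h2 := (hasDerivAt_solitonTau hκ hγ hσ (n - 1) t).log (hp (n - 1) t).ne'
  have h3 : (fun s => solitonQ q₀ κ γ σ n s) = fun s => q₀ -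
      (Real.log (solitonTau κ γ σ n s) - Real.log (solitonTau κ γ σ (n - 1) s)) := by
    funext s
    rw [solitonQ, Real.log_div (hp n s).ne' (hp (n - 1) s).ne']
  rw [h3]
  refine ((h1.sub h2).const_sub q₀).congr_deriv ?_
  have := (hp n t).ne'
  have := (hp (n - 1) t).ne'
  field_simp
  ring

/-- The exponential interaction terms of the soliton solution in terms of the tau function. -/
theorem exp_solitonQ_sub (q₀ : ℝ) (n : ℤ) (t : ℝ) :
    Real.exp (solitonQ q₀ κ γ σ n t - solitonQ q₀ κ γ σ (n + 1) t) =
      solitonTau κ γ σ (n + 1) t * solitonTau κ γ σ (n - 1) t / solitonTau κ γ σ n t ^ 2 := by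
  have hp := fun n s => solitonTau_pos hκ hγ hσ n s
  have h1 := hp (n + 1) t
  have h2 := hp n t
  have h3 := hp (n - 1) t
  rw [solitonQ, solitonQ, add_sub_cancel_right, sub_sub_sub_cancel_left, Real.exp_sub,
    Real.exp_log (div_pos h1 h2), Real.exp_log (div_pos h2 h3)]
  field_simp

theorem hasDerivAt_solitonVelocity (q₀ : ℝ) (n : ℤ) (t : ℝ) :
    HasDerivAt (fun s => solitonRho κ γ σ n s - solitonRho κ γ σ (n - 1) s)
      (chain.accel todaU (fun m => solitonQ q₀ κ γ σ m t) n) t := by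
  refine ((hasDerivAt_solitonRho hκ hγ hσ n t).sub
    (hasDerivAt_solitonRho hκ hγ hσ (n - 1) t)).congr_deriv ?_
  have h := exp_solitonQ_sub hκ hγ hσ q₀ (n - 1) t
  rw [sub_add_cancel] at h
  rw [chain_accel_todaU, exp_solitonQ_sub hκ hγ hσ, h, sub_add_cancel]
  ring

/-- Solitons connect two constant states at rest, which do not depend on the time. -/
theorem soliton_asymptotics (q₀ : ℝ) : ∃ a b : ℝ, ∀ t : ℝ,
    Tendsto (fun n => solitonQ q₀ κ γ σ n t) atTop (𝓝 a) ∧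
    Tendsto (fun n => solitonQ q₀ κ γ σ n t) atBot (𝓝 b) ∧
    Tendsto (fun n => solitonRho κ γ σ n t - solitonRho κ γ σ (n - 1) t) atTop (𝓝 0) ∧
    Tendsto (fun n => solitonRho κ γ σ n t - solitonRho κ γ σ (n - 1) t) atBot (𝓝 0) := by
  have hc := solitonCoeff_nonneg hκ hγ hσ
  have hpos := exists_solitonCoeff_pos (κ := κ) (γ := γ) (σ := σ)
  obtain ⟨A, hA⟩ := expSum_asymptotics hc (solitonExpX κ) (solitonExpT κ σ) hpos
  -- the limit at `-∞` is the limit at `+∞` for the opposite spatial exponents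
  obtain ⟨B, hB⟩ := expSum_asymptotics hc (fun s => -solitonExpX κ s) (solitonExpT κ σ) hpos
  have hcast : Tendsto (fun n : ℤ => (n : ℝ)) atTop atTop := tendsto_intCast_atTop_atTop
  have hcast' : Tendsto (fun n : ℤ => -(n : ℝ)) atBot atTop :=
    tendsto_neg_atBot_atTop.comp (tendsto_intCast_atBot_iff.2 tendsto_id)
  have hflip : ∀ x t,
      expSum (solitonCoeff κ γ σ) (fun s => -solitonExpX κ s) (solitonExpT κ σ) x t =
      expSum (solitonCoeff κ γ σ) (solitonExpX κ) (solitonExpT κ σ) (-x) t := fun x t => by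
    simp only [expSum, neg_mul, mul_neg]
  refine ⟨q₀ - Real.log (Real.exp (A * -1))⁻¹, q₀ - Real.log (Real.exp (B * 1))⁻¹, fun t => ?_⟩
  obtain ⟨hA₁, D, hD⟩ := hA t
  obtain ⟨hB₁, D', hD'⟩ := hB t
  refine ⟨?_, ?_, ?_, ?_⟩
  · refine Tendsto.const_sub q₀ (Tendsto.log ?_ (inv_ne_zero (Real.exp_pos _).ne'))
    refine (((hA₁ (-1)).comp hcast).inv₀ (Real.exp_pos _).ne').congr fun n => ?_
    rw [solitonTau_eq_expSum hγ, solitonTau_eq_expSum hγ, Function.comp_apply, inv_div]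
    push_cast
    rfl
  · refine Tendsto.const_sub q₀ (Tendsto.log ?_ (inv_ne_zero (Real.exp_pos _).ne'))
    refine (((hB₁ 1).comp hcast').inv₀ (Real.exp_pos _).ne').congr fun n => ?_
    rw [solitonTau_eq_expSum hγ, solitonTau_eq_expSum hγ, Function.comp_apply, inv_div, hflip,
      hflip, neg_neg, neg_add, neg_neg]
    push_cast
    rfl
  · have h : Tendsto (fun n : ℤ => solitonRho κ γ σ n t) atTop (𝓝 (-D)) :=
      (hD.comp hcast).neg.congr fun n => (solitonRho_eq hκ hγ hσ n t).symm
    simpa [sub_eq_add_neg] using h.sub (h.comp (tendsto_atTop_add_const_right _ (-1) tendsto_id))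
  · have h : Tendsto (fun n : ℤ => solitonRho κ γ σ n t) atBot (𝓝 (-D')) :=
      (hD'.comp hcast').neg.congr fun n => by
        rw [solitonRho_eq hκ hγ hσ n t, Function.comp_apply, hflip, neg_neg]
        simp only [neg_mul, mul_neg, neg_neg]
    simpa [sub_eq_add_neg] using h.sub (h.comp (tendsto_atBot_add_const_right _ (-1) tendsto_id))

/-- The soliton solution as a curve in phase space. -/
theorem exists_soliton_solution (q₀ : ℝ) : ∃ c : ℝ → Phase ℤ,
    (∀ t n, (c t).1 n = solitonQ q₀ κ γ σ n t) ∧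
    (∀ t n, (c t).2 n = solitonRho κ γ σ n t - solitonRho κ γ σ (n - 1) t) ∧
    chain.IsSolutionOn todaU c univ := by
  obtain ⟨B₁, hB₁⟩ := exists_abs_solitonQ_le hκ hγ hσ q₀
  obtain ⟨B₂, hB₂⟩ := exists_abs_solitonRho_le hκ hγ hσ
  have hv : ∀ n t, |solitonRho κ γ σ n t - solitonRho κ γ σ (n - 1) t| ≤ B₂ + B₂ := fun n t =>
    (abs_sub _ _).trans (add_le_add (hB₂ _ _) (hB₂ _ _))
  have hexp : ∀ n m t, Real.exp (solitonQ q₀ κ γ σ n t - solitonQ q₀ κ γ σ m t) ≤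
      Real.exp (2 * B₁) :=
    fun n m t => Real.exp_le_exp.2 (by
      linarith [(abs_le.1 (hB₁ n t)).2, (abs_le.1 (hB₁ m t)).1])
  refine ⟨fun t => (⟨fun n => solitonQ q₀ κ γ σ n t, memℓp_infty ⟨B₁, ?_⟩⟩,
    ⟨fun n => solitonRho κ γ σ n t - solitonRho κ γ σ (n - 1) t, memℓp_infty ⟨B₂ + B₂, ?_⟩⟩),
    fun _ _ => rfl, fun _ _ => rfl, ?_⟩
  · rintro _ ⟨n, rfl⟩
    exact hB₁ n t
  · rintro _ ⟨n, rfl⟩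
    exact hv n t
  · refine chain_isSolutionOn_of_forall_apply (B := max (B₂ + B₂) (Real.exp (2 * B₁)))
      (fun n t => (hv n t).trans (le_max_left _ _)) (le_max_of_le_right (Real.exp_pos _).le)
      (fun t n => ?_) (fun n t => hasDerivAt_solitonQ hκ hγ hσ q₀ n t)
      (fun n t => hasDerivAt_solitonVelocity hκ hγ hσ q₀ n t)
    rw [chain_accel_todaU]
    refine le_trans ?_ (le_max_right _ _)
    exact abs_sub_le_of_nonneg_of_le (Real.exp_pos _).le (hexp _ _ t) (Real.exp_pos _).le
      (hexp _ _ t)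

end Soliton

end GradedToda

theorem mainTheorem3 {V : Type*} (G : GradedToda.MeasuredZGradedGraph V) (hG : G.Balanced) :
    -- every initial value on the chain has a global solution, and its lift is global on `G`
    (∀ z₀ : GradedToda.Phase ℤ, ∃ c : ℝ → GradedToda.Phase ℤ,
      c 0 = z₀ ∧
      GradedToda.chain.IsSolutionOn GradedToda.todaU c univ ∧
      (∀ (I : Set ℝ) (d : ℝ → GradedToda.Phase ℤ), I.OrdConnected → (0 : ℝ) ∈ I →
        GradedToda.chain.IsSolutionOn GradedToda.todaU d I → d 0 = z₀ → EqOn d c I) ∧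
      G.IsSolutionOn GradedToda.todaU (fun t => G.lift (c t)) univ ∧
      (∀ (I : Set ℝ) (d : ℝ → GradedToda.Phase V), I.OrdConnected → (0 : ℝ) ∈ I →
        G.IsSolutionOn GradedToda.todaU d I → d 0 = G.lift z₀ →
        EqOn d (fun t => G.lift (c t)) I)) ∧
    -- the `N`-soliton solution of the chain lifts to an `N`-soliton solution on `G`
    (∀ (N : ℕ) (q₀ : ℝ) (κ γ σ : Fin N → ℝ),
      (∀ j, 0 < κ j) → (∀ j, 0 < γ j) → (∀ j, σ j = 1 ∨ σ j = -1) →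
      (∀ n t, 0 < GradedToda.solitonTau κ γ σ n t) ∧
      ∃ c : ℝ → GradedToda.Phase ℤ,
        (∀ t n, (c t).1 n = GradedToda.solitonQ q₀ κ γ σ n t ∧
          (c t).2 n = deriv (fun s => GradedToda.solitonQ q₀ κ γ σ n s) t) ∧
        GradedToda.chain.IsSolutionOn GradedToda.todaU c univ ∧
        G.IsSolutionOn GradedToda.todaU (fun t => G.lift (c t)) univ ∧
        G.TendsToConstants (fun t => G.lift (c t)) ∧
        (∀ (I : Set ℝ) (d : ℝ → GradedToda.Phase V), I.OrdConnected → (0 : ℝ) ∈ I →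
          G.IsSolutionOn GradedToda.todaU d I → d 0 = G.lift (c 0) →
          EqOn d (fun t => G.lift (c t)) I)) := by
  have huniq : ∀ c : ℝ → GradedToda.Phase ℤ, GradedToda.chain.IsSolutionOn GradedToda.todaU c univ →
      ∀ (I : Set ℝ) (d : ℝ → GradedToda.Phase V), I.OrdConnected → (0 : ℝ) ∈ I →
        G.IsSolutionOn GradedToda.todaU d I → d 0 = G.lift (c 0) →
        EqOn d (fun t => G.lift (c t)) I := by
    intro c hc I d hI h0 hd hd0
    exact hd.eqOn hG hI h0 ((hG.lift_isSolutionOn hc).mono (subset_univ I)) hd0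
  refine ⟨fun z₀ => ?_, fun N q₀ κ γ σ hκ hγ hσ => ?_⟩
  · obtain ⟨c, h0, hc⟩ := GradedToda.exists_chain_solution z₀
    refine ⟨c, h0, hc, fun I d hI h0I hd hd0 => ?_, hG.lift_isSolutionOn hc, h0 ▸ huniq c hc⟩
    exact hd.eqOn GradedToda.chain_balanced hI h0I (hc.mono (subset_univ I)) (hd0.trans h0.symm)
  · obtain ⟨c, hc1, hc2, hc⟩ := GradedToda.exists_soliton_solution hκ hγ hσ q₀
    refine ⟨GradedToda.solitonTau_pos hκ hγ hσ, c, fun t n => ⟨hc1 t n, ?_⟩, hc,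
      hG.lift_isSolutionOn hc, ?_, huniq c hc⟩
    · rw [hc2, (GradedToda.hasDerivAt_solitonQ hκ hγ hσ q₀ n t).deriv]
    · obtain ⟨a, b, hab⟩ := GradedToda.soliton_asymptotics hκ hγ hσ q₀
      refine ⟨a, b, fun t => ?_⟩
      obtain ⟨h1, h2, h3, h4⟩ := hab t
      simp_rw [← hc1] at h1 h2
      simp_rw [← hc2] at h3 h4
      exact ⟨h1.comp tendsto_comap, h2.comp tendsto_comap, h3.comp tendsto_comap,
        h4.comp tendsto_comap⟩
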